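/- Let $X$ be a smooth manifold of dimension $n$ and let $K_1,\dots,K_n$ be smooth, pairwise commuting operator fields (that is, $(1,1)$-tensor fields) on $X$ that span an operator Frobenius algebra: at every point $x\in X$ there is $\xi\in T_xX$ such that $K_1\xi,\dots,K_n\xi$ are linearly independent, and there is $\alpha\in T_x^*X$ such that $K_1^*\alpha,\dots,K_n^*\alpha$ are linearly independent. Then $K_iK_j=\sum_k a_{ij}^kK_k$ with uniquely determined smooth functions $a_{ij}^k$. Let $a_1,\dots,a_n\in\mathbb R$ be constants such that the matrix $b_{ij}(x)=\sum_k a_{ij}^k(x)\,a_k$ is non-degenerate at every $x\in X$, let $(b^{ij})$ be its inverse, and let $M^i=\sum_j b^{ij}K_j$ be the dual basis. For commuting operator fields $L,N$ put $\langle L,N\rangle(\xi,\eta)=LN[\xi,\eta]+[L\xi,N\eta]-L[\xi,N\eta]-N[L\xi,\eta]$. Smooth commuting operator fields $L,N$ are called symmetries of each other if the symmetric part of the tensor field $\langle L,N\rangle$ vanishes. A closed $1$-form $\alpha$ is called a conservation law of $L$ if $L^*\alpha=\alpha\circ L$ is closed. "Common" means: for every operator field of the family. The $K_i$ and $M^i$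 are defined on all of $X$; statements (2) and (3) hold on every open subset $U\subseteq X$, and all functions in them are smooth. Assume that $K_1,\dots,K_n$ are symmetries of each other. Then: (1) $M^1,\dots,M^n$ are smooth and are symmetries of each other. (2) For functions $h^1,\dots,h^n$ on $U$ and $h=\sum_s a_sh^s$, the operator field $K=\sum_i h^iK_i$ is a common symmetry of $K_1,\dots,K_n$ on $U$ if and only if $\mathrm dh$ is a common conservation law of $M^1,\dots,M^n$ on $U$ with $M^{i*}\mathrm dh=\mathrm dh^i$ for all $i$. Moreover, for a function $f$ on $U$, $\mathrm df$ is a common conservation law of $M^1,\dots,M^n$ if and only if it arises in this way locally: every point of $U$ has an open neighbourhood with functions $h^1,\dots,h^n$ on it such that $\mathrm df=\mathrm d\big(\sum_s a_sh^s\big)$, $M^{i*}\mathrm df=\mathrm dh^i$ for all $i$, and $\sum_i h^iK_i$ is a common symmetry of $K_1,\dots,K_n$ on it. (3) Suppose in addition that $\mathrm{Id}=\sum_i\beta^iK_i$ with constants $\beta^i\in\mathbb R$. Then, for a function $f$ on $U$, $\mathrm df$ is a common conservation law of $K_1,\dots,K_n$ if and only if every point of $U$ has an open neighbourhood with functions $f_1,\dots,f_n$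 on it such that $K_i^*\mathrm df=\mathrm df_i$ for all $i$ and $M=\sum_i f_iM^i$ is a common symmetry of $M^1,\dots,M^n$ on it. Moreover, whenever functions $f,f_1,\dots,f_n$ on $U$ satisfy $K_i^*\mathrm df=\mathrm df_i$ for all $i$, the operator field $\sum_i f_iM^i$ is a common symmetry of $M^1,\dots,M^n$ on $U$; and conversely, whenever $\sum_i f_iM^i$ is a common symmetry of $M^1,\dots,M^n$ on $U$, the form $\mathrm df$ with $f=\sum_i\beta^if_i$ is a common conservation law of $K_1,\dots,K_n$ on $U$ and $K_i^*\mathrm df=\mathrm df_i$ for all $i$. -/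

import Mathlib

open Bundle Set
open scoped Manifold ContDiff Topology

noncomputable section

namespace OperatorFrobenius

variable {n : ℕ} {X : Type*} [TopologicalSpace X] [ChartedSpace (EuclideanSpace ℝ (Fin n)) X]

/-- A vector field on the `n`-dimensional manifold `X` (no regularity is built in). -/
abbrev VField (n : ℕ) (X : Type*) [TopologicalSpace X]
    [ChartedSpace (EuclideanSpace ℝ (Fin n)) X] :=
  ∀ x : X, TangentSpace (𝓡 n) x

/-- An operator field on `X`, that is, a `(1,1)`-tensor field (no regularity is built in). -/
abbrev OpField (n : ℕ) (X : Type*) [TopologicalSpace X]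
    [ChartedSpace (EuclideanSpace ℝ (Fin n)) X] :=
  ∀ x : X, TangentSpace (𝓡 n) x →L[ℝ] TangentSpace (𝓡 n) x

/-- A `1`-form on `X` (no regularity is built in). -/
abbrev OneForm (n : ℕ) (X : Type*) [TopologicalSpace X]
    [ChartedSpace (EuclideanSpace ℝ (Fin n)) X] :=
  ∀ x : X, TangentSpace (𝓡 n) x →L[ℝ] ℝ

/-- The vector field `ξ` is smooth on `U`. -/
def SmoothVFieldOn [IsManifold (𝓡 n) ∞ X] (U : Set X) (ξ : VField n X) : Prop :=
  ContMDiffOn (𝓡 n) (𝓡 n).tangent ∞ (fun x => (⟨x, ξ x⟩ : TangentBundle (𝓡 n) X)) U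

/-- The function `f` is smooth on `U`. -/
def SmoothFunOn (n : ℕ) {X : Type*} [TopologicalSpace X]
    [ChartedSpace (EuclideanSpace ℝ (Fin n)) X] (U : Set X) (f : X → ℝ) : Prop :=
  ContMDiffOn (𝓡 n) 𝓘(ℝ, ℝ) ∞ f U

/-- The operator field `L` is smooth on `U`, as a section of the bundle `Hom(TX, TX)`. -/
def SmoothOpFieldOn [IsManifold (𝓡 n) ∞ X] (U : Set X) (L : OpField n X) : Prop :=
  ContMDiffOn (𝓡 n)
    ((𝓡 n).prod 𝓘(ℝ, EuclideanSpace ℝ (Fin n) →L[ℝ] EuclideanSpace ℝ (Fin n))) ∞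
    (fun x => TotalSpace.mk' (EuclideanSpace ℝ (Fin n) →L[ℝ] EuclideanSpace ℝ (Fin n))
      (E := fun y : X => TangentSpace (𝓡 n) y →L[ℝ] TangentSpace (𝓡 n) y) x (L x)) U

/-- The commutator `[ξ, η]` of two vector fields. -/
def bracket (ξ η : VField n X) : VField n X := VectorField.mlieBracket (𝓡 n) ξ η

/-- The vector field `L ξ`. -/
def applyOp (L : OpField n X) (ξ : VField n X) : VField n X := fun x => L x (ξ x)

/-- The expression
`⟨L, N⟩(ξ, η) = L N [ξ, η] + [L ξ, N η] - L [ξ, N η] - N [L ξ, η]`. -/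
def bracketTensor (L N : OpField n X) (ξ η : VField n X) : VField n X := fun x =>
  L x (N x (bracket ξ η x)) + bracket (applyOp L ξ) (applyOp N η) x
    - L x (bracket ξ (applyOp N η) x) - N x (bracket (applyOp L ξ) η x)

/-- The smooth operator fields `L` and `N` are symmetries of each other on the open set `U`: they
commute, and the symmetric part of `⟨L, N⟩` vanishes.  As `⟨L, N⟩` is a tensor field when `L` and
`N` commute, it is evaluated on all pairs of vector fields that are defined and smooth on some open
subset of `U`. -/
structure IsSymmetryOn [IsManifold (𝓡 n) ∞ X] (U : Set X) (L N : OpField n X) : Prop where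
  smooth_left : SmoothOpFieldOn U L
  smooth_right : SmoothOpFieldOn U N
  commute : ∀ x ∈ U, (L x).comp (N x) = (N x).comp (L x)
  symm_part : ∀ V : Set X, IsOpen V → V ⊆ U → ∀ ξ η : VField n X,
    SmoothVFieldOn V ξ → SmoothVFieldOn V η →
      ∀ x ∈ V, bracketTensor L N ξ η x + bracketTensor L N η ξ x = 0

/-- The operator fields `K_1, …, K_n` are symmetries of each other on `U`. -/
def MutualSymmetriesOn [IsManifold (𝓡 n) ∞ X] (U : Set X) (K : Fin n → OpField n X) : Prop :=
  ∀ i j, IsSymmetryOn U (K i) (K j)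

/-- `L` is a common symmetry of `K 1, …, K n` on `U`. -/
def IsCommonSymmetryOn [IsManifold (𝓡 n) ∞ X] (U : Set X) (K : Fin n → OpField n X)
    (L : OpField n X) : Prop :=
  ∀ i, IsSymmetryOn U (K i) L

/-- The differential `d f : ξ ↦ ξ(f)` of a function. -/
def differential (n : ℕ) {X : Type*} [TopologicalSpace X]
    [ChartedSpace (EuclideanSpace ℝ (Fin n)) X] (f : X → ℝ) : OneForm n X :=
  fun x => mvfderiv (𝓡 n) f x

/-- The `1`-form `L^* α`, given by `(L^* α)(ξ) = α(L ξ)`. -/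
def pullForm (L : OpField n X) (α : OneForm n X) : OneForm n X := fun x => (α x).comp (L x)

/-- The exterior derivative of a `1`-form,
`dα(ξ, η) = ξ(α(η)) - η(α(ξ)) - α([ξ, η])`, as a function on `X`. -/
def extDerivForm (α : OneForm n X) (ξ η : VField n X) : X → ℝ := fun x =>
  differential n (fun y => α y (η y)) x (ξ x) - differential n (fun y => α y (ξ y)) x (η x)
    - α x (bracket ξ η x)

/-- The (smooth) `1`-form `α` is closed on the open set `U`. -/
def IsClosedFormOn [IsManifold (𝓡 n) ∞ X] (U : Set X) (α : OneForm n X) : Prop :=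
  ∀ V : Set X, IsOpen V → V ⊆ U → ∀ ξ η : VField n X,
    SmoothVFieldOn V ξ → SmoothVFieldOn V η → ∀ x ∈ V, extDerivForm α ξ η x = 0

/-- `α` is a conservation law of `L` on `U`: both `α` and `L^* α` are closed. -/
def IsConservationLawOn [IsManifold (𝓡 n) ∞ X] (U : Set X) (L : OpField n X) (α : OneForm n X) : Prop :=
  IsClosedFormOn U α ∧ IsClosedFormOn U (pullForm L α)

/-- The `1`-form `α` is a common conservation law of `K 1, …, K n` on `U`. -/
def IsCommonConservationLawOn [IsManifold (𝓡 n) ∞ X] (U : Set X)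
    (K : Fin n → OpField n X) (α : OneForm n X) : Prop :=
  ∀ i, IsConservationLawOn U (K i) α

/-- The combination `h 1 • K 1 + ⋯ + h n • K n` with functional coefficients. -/
def combination (h : Fin n → X → ℝ) (K : Fin n → OpField n X) : OpField n X :=
  fun x => ∑ i, h i x • K i x

/-- `K 1, …, K n` span an operator Frobenius algebra on the `n`-dimensional manifold `X`: they are
smooth and commute, and at every point `x` the conditions (A1) and (A2) hold, that is,
`K 1 ξ, …, K n ξ` are linearly independent for some `ξ ∈ T_x X`, and `K 1^* α, …, K n^* α` are
linearly independent for some `α ∈ T_x^* X`.  It follows that the span of `K 1 (x), …, K n (x)` is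
an `n`-dimensional unital subalgebra of `End (T_x X)`. -/
structure IsOperatorFrobeniusAlgebra [IsManifold (𝓡 n) ∞ X] (K : Fin n → OpField n X) :
    Prop where
  smooth : ∀ i, SmoothOpFieldOn univ (K i)
  commute : ∀ i j x, (K i x).comp (K j x) = (K j x).comp (K i x)
  exists_generic_vector : ∀ x, ∃ ξ : TangentSpace (𝓡 n) x,
    LinearIndependent ℝ (fun i => K i x ξ)
  exists_generic_covector : ∀ x, ∃ α : TangentSpace (𝓡 n) x →L[ℝ] ℝ,
    LinearIndependent ℝ (fun i => α.comp (K i x))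

/-- The structure functions: `k ↦ structureFun K i j x k` is the coefficient vector with
`K i (x) K j (x) = ∑ k, a_{ij}^k (x) K k (x)`.  For an operator Frobenius algebra it exists and is
unique. -/
def structureFun (K : Fin n → OpField n X) (i j : Fin n) (x : X) : Fin n → ℝ :=
  Classical.epsilon fun c : Fin n → ℝ => (K i x).comp (K j x) = ∑ k, c k • K k x

/-- The matrix `b_{ij}(x) = ∑ k, a_{ij}^k (x) a_k` of the form `b_a` in the basis `K 1, …, K n`. -/
def frobeniusForm (K : Fin n → OpField n X) (a : Fin n → ℝ) (x : X) :
    Matrix (Fin n) (Fin n) ℝ :=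
  Matrix.of fun i j => ∑ k, structureFun K i j x k * a k

/-- The dual basis `M^i = ∑ j, b^{ij} K_j` with respect to `b_a`, where `(b^{ij})` is the inverse
of the matrix `(b_{ij})`. -/
def dualBasis (K : Fin n → OpField n X) (a : Fin n → ℝ) (i : Fin n) : OpField n X :=
  fun x => ∑ j, (frobeniusForm K a x)⁻¹ i j • K j x

end OperatorFrobenius

end

open OperatorFrobenius

/-!
Let `∇` be the connection on the span of the `K_i` for which the `K_i` are parallel. If
`K_1, …, K_n` are symmetries of `L`, then by the Leibniz rule `⟨L, N⟩(ξ, ξ)` is, for a combination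
`N = ∑ h^i K_i`, the value `Φ (L ξ) ξ - L (Φ ξ ξ)` with `Φ v = ∇_v N`. An algebra valued linear map
`Φ` with `Φ v v = 0` for all `v` vanishes, as one sees by putting first `v = ξ` and then `v = v + ξ`
for a generic vector `ξ`; so `N` is a common symmetry if and only if `∇N` is linear over the
algebra. Choose a covector `α` with `α (K_k ξ) = a_k`, so that `b_ij = α (K_i K_j ξ)`. Paired with
`α` and `M^i`, linearity over the algebra becomes `M^{i*} dh = dh^i`, which is (2) up to the
Poincaré lemma, which supplies the local potentials.

For (1), the derivative of `b⁻¹` is `-b⁻¹ (db) b⁻¹`, so it has to be shown that the linearity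
defect over `K_p` of the derivative of the row `r` of `b` is symmetric in `p` and `r`. This follows
from the same statement for the structure functions, a consequence of the symmetry condition for
`K_p` and `K_r` on the pair `ξ, K_l ξ`, and from the derivative of the associativity relation.

For (3), the matrix that `β` induces on the basis `M^i` is `b⁻¹`, so `K` is the dual basis of `M`
and (2) applies with `K` and `M` exchanged.
-/

namespace OperatorFrobenius

section LinearityDefect

variable {𝕜 V : Type*} [Field 𝕜] [AddCommGroup V] [Module 𝕜 V] [TopologicalSpace V]
  [IsTopologicalAddGroup V] [ContinuousConstSMul 𝕜 V]

/-- The failure `v ↦ Φ (P v) - P * Φ v` of an operator valued linear map to be linear over the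
operator `P`. For a combination `N` of symmetries of `L` with functional coefficients, the
symmetric part of `⟨L, N⟩` is such a defect of the derivative of `N`. -/
def linearityDefect (P : V →L[𝕜] V) (Φ : V →ₗ[𝕜] V →L[𝕜] V) : V →ₗ[𝕜] V →L[𝕜] V :=
  Φ ∘ₗ (P : V →ₗ[𝕜] V) - LinearMap.mulLeft 𝕜 P ∘ₗ Φ

lemma linearityDefect_apply (P : V →L[𝕜] V) (Φ : V →ₗ[𝕜] V →L[𝕜] V) (v : V) :
    linearityDefect P Φ v = Φ (P v) - P * Φ v :=
  rfl

lemma linearityDefect_sum_smul {ι : Type*} [Fintype ι] (c d : ι → 𝕜) (A : ι → V →L[𝕜] V)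
    (Φ : ι → V →ₗ[𝕜] V →L[𝕜] V) :
    linearityDefect (∑ p, c p • A p) (∑ r, d r • Φ r) =
      ∑ p, ∑ r, (c p * d r) • linearityDefect (A p) (Φ r) := by
  ext v w
  simp only [linearityDefect_apply, LinearMap.sum_apply, LinearMap.smul_apply, sum_apply,
    smul_apply, sub_apply, mul_apply_eq_comp, map_sum, map_smul, smul_sub, Finset.sum_sub_distrib,
    Finset.smul_sum, mul_smul]
  rw [Finset.sum_comm]
  simp only [smul_comm (d _) (c _)]
  exact congrArg (_ - ·) Finset.sum_comm

lemma linearityDefect_sum_smul_comm {ι : Type*} [Fintype ι] {A : ι → V →L[𝕜] V}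
    {Φ : ι → V →ₗ[𝕜] V →L[𝕜] V}
    (h : ∀ p r, linearityDefect (A p) (Φ r) = linearityDefect (A r) (Φ p)) (c d : ι → 𝕜) :
    linearityDefect (∑ p, c p • A p) (∑ r, d r • Φ r) =
      linearityDefect (∑ p, d p • A p) (∑ r, c r • Φ r) := by
  rw [linearityDefect_sum_smul, linearityDefect_sum_smul, Finset.sum_comm]
  simp only [h, mul_comm]

lemma commute_linearityDefect {P Q : V →L[𝕜] V} {Φ : V →ₗ[𝕜] V →L[𝕜] V} (hP : Commute Q P)
    (hΦ : ∀ v, Commute Q (Φ v)) (v : V) : Commute Q (linearityDefect P Φ v) :=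
  (hΦ _).sub_right (hP.mul_right (hΦ v))

end LinearityDefect

section DualPair

variable {𝕜 V ι : Type*} [Field 𝕜] [AddCommGroup V] [Module 𝕜 V] [TopologicalSpace V]
  [Fintype ι] [DecidableEq ι]

/-- Two commuting families of operators, as many as the dimension of `V`, that are dual bases for
the form `(P, Q) ↦ α (P (Q ξ))`. It is the pointwise model of an operator Frobenius algebra with a
basis, its dual basis, a generic vector `ξ`, and a covector `α` that induces the Frobenius form. -/
structure IsDualPair (A D : ι → V →L[𝕜] V) (ξ : V) (α : V →ₗ[𝕜] 𝕜) : Prop where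
  commute_left : ∀ i j, Commute (A i) (A j)
  commute_right : ∀ i j, Commute (D i) (D j)
  commute : ∀ i j, Commute (A i) (D j)
  finrank_eq : Module.finrank 𝕜 V = Fintype.card ι
  dual : ∀ i j, α (D i (A j ξ)) = if i = j then 1 else 0

namespace IsDualPair

variable {A D : ι → V →L[𝕜] V} {ξ : V} {α : V →ₗ[𝕜] 𝕜}

lemma symm (h : IsDualPair A D ξ α) : IsDualPair D A ξ α where
  commute_left := h.commute_right
  commute_right := h.commute_left
  commute i j := (h.commute j i).symm
  finrank_eq := h.finrank_eq
  dual i j := by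
    have : A i (D j ξ) = D j (A i ξ) := DFunLike.congr_fun (h.commute i j).eq ξ
    simp only [this, h.dual, eq_comm]

lemma apply_sum_smul (h : IsDualPair A D ξ α) (c : ι → 𝕜) (i : ι) :
    α (D i (∑ j, c j • A j ξ)) = c i := by
  simp [h.dual]

lemma linearIndependent (h : IsDualPair A D ξ α) : LinearIndependent 𝕜 fun i => A i ξ :=
  Fintype.linearIndependent_iff.2 fun c hc i => by
    rw [← h.apply_sum_smul c i, hc, map_zero, map_zero]

lemma linearIndependent_comp (h : IsDualPair A D ξ α) :
    LinearIndependent 𝕜 fun i => α ∘ₗ (A i : V →ₗ[𝕜] V) :=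
  Fintype.linearIndependent_iff.2 fun c hc i => by
    simpa [h.symm.dual] using LinearMap.congr_fun hc (D i ξ)

lemma sum_smul_apply [FiniteDimensional 𝕜 V] (h : IsDualPair A D ξ α) (w : V) :
    ∑ i, α (D i w) • A i ξ = w := by
  have hw : w ∈ Submodule.span 𝕜 (Set.range fun i => A i ξ) := by
    rw [h.linearIndependent.span_eq_top_of_card_eq_finrank' h.finrank_eq.symm]
    trivial
  obtain ⟨c, rfl⟩ := (Submodule.mem_span_range_iff_exists_fun 𝕜).1 hw
  simp only [h.apply_sum_smul]

lemma eq_of_forall_right [FiniteDimensional 𝕜 V] (h : IsDualPair A D ξ α) {v w : V}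
    (hvw : ∀ i, α (D i v) = α (D i w)) : v = w := by
  rw [← h.sum_smul_apply v, ← h.sum_smul_apply w]
  simp only [hvw]

lemma eq_of_apply_eq [FiniteDimensional 𝕜 V] (h : IsDualPair A D ξ α) {P Q : V →L[𝕜] V}
    (hP : ∀ i, Commute (A i) P) (hQ : ∀ i, Commute (A i) Q) (hPQ : P ξ = Q ξ) : P = Q := by
  ext w
  have hP' (i : ι) : P (A i ξ) = A i (P ξ) := DFunLike.congr_fun (hP i).eq.symm ξ
  have hQ' (i : ι) : Q (A i ξ) = A i (Q ξ) := DFunLike.congr_fun (hQ i).eq.symm ξ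
  rw [← h.sum_smul_apply w]
  simp only [map_sum, map_smul, hP', hQ', hPQ]

lemma right_mul_right [FiniteDimensional 𝕜 V] (h : IsDualPair A D ξ α) :
    Matrix.of (fun i j => α (D i (D j ξ))) = (Matrix.of fun i j => α (A i (A j ξ)))⁻¹ := by
  refine (Matrix.inv_eq_left_inv ?_).symm
  ext i j
  have := congrArg (fun w => α (D i w)) (h.symm.sum_smul_apply (A j ξ))
  simpa only [Matrix.mul_apply, Matrix.of_apply, map_sum, map_smul, smul_eq_mul, mul_comm, h.dual,
    Matrix.one_apply] using this

variable [IsTopologicalAddGroup V] [ContinuousConstSMul 𝕜 V]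

lemma of_inv {B : Matrix ι ι 𝕜} (hA : ∀ i j, Commute (A i) (A j))
    (hV : Module.finrank 𝕜 V = Fintype.card ι) (hB : ∀ i j, B i j = α (A i (A j ξ)))
    (hdet : B.det ≠ 0) : IsDualPair A (fun i => ∑ j, B⁻¹ i j • A j) ξ α where
  commute_left := hA
  commute_right i j := .sum_left _ _ _ fun p _ => .sum_right _ _ _ fun q _ =>
    ((hA p q).smul_left _).smul_right _
  commute i j := .sum_right _ _ _ fun q _ => (hA i q).smul_right _
  finrank_eq := hV
  dual i j := by
    have := congrFun₂ (Matrix.nonsing_inv_mul B hdet.isUnit) i j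
    simpa only [Matrix.mul_apply, hB, Matrix.one_apply, sum_apply, smul_apply, map_sum, map_smul,
      smul_eq_mul] using this

lemma of_linearIndependent [FiniteDimensional 𝕜 V] (hA : ∀ i j, Commute (A i) (A j))
    (hV : Module.finrank 𝕜 V = Fintype.card ι) (hξ : LinearIndependent 𝕜 fun i => A i ξ)
    (hα : LinearIndependent 𝕜 fun i => α ∘ₗ (A i : V →ₗ[𝕜] V)) :
    IsDualPair A (fun i => ∑ j, (Matrix.of fun i j => α (A i (A j ξ)))⁻¹ i j • A j) ξ α := by
  refine of_inv hA hV (fun _ _ => rfl) (isUnit_iff_ne_zero.1 ?_)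
  rw [← Matrix.isUnit_iff_isUnit_det, ← Matrix.linearIndependent_rows_iff_isUnit,
    Fintype.linearIndependent_iff]
  intro c hc
  refine Fintype.linearIndependent_iff.1 hα c ?_
  refine LinearMap.ext_on_range (hξ.span_eq_top_of_card_eq_finrank' hV.symm) fun j => ?_
  simpa using congrFun hc j

variable [FiniteDimensional 𝕜 V]

lemma sum_smul_eq (h : IsDualPair A D ξ α) {P : V →L[𝕜] V} (hP : ∀ i, Commute (A i) P) :
    ∑ i, α (D i (P ξ)) • A i = P :=
  h.eq_of_apply_eq (fun i => .sum_right _ _ _ fun j _ => (h.commute_left i j).smul_right _) hP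
    (by simpa using h.sum_smul_apply (P ξ))

lemma eq_zero_of_forall_self (h : IsDualPair A D ξ α) {Φ : V →ₗ[𝕜] V →L[𝕜] V}
    (hΦ : ∀ v i, Commute (A i) (Φ v)) (hself : ∀ v, Φ v v = 0) : Φ = 0 := by
  have hξ : Φ ξ = 0 :=
    h.eq_of_apply_eq (hΦ ξ) (fun _ => .zero_right _) (by rw [hself]; rfl)
  ext1 v
  refine h.eq_of_apply_eq (hΦ v) (fun _ => .zero_right _) ?_
  simpa [hself, hξ] using hself (v + ξ)

lemma forall_linearityDefect_eq_zero_iff (h : IsDualPair A D ξ α) {Φ : V →ₗ[𝕜] V →L[𝕜] V}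
    (hΦ : ∀ v i, Commute (A i) (Φ v)) :
    (∀ i, linearityDefect (A i) Φ = 0) ↔ ∀ i v, α (Φ (D i v) ξ) = α (D i (Φ v ξ)) := by
  simp only [LinearMap.ext_iff, linearityDefect_apply, LinearMap.zero_apply, sub_eq_zero]
  constructor
  · intro hA i v
    have hD : Φ (D i v) = D i * Φ v := by
      rw [← h.sum_smul_eq (h.commute · i)]
      simp only [sum_apply, smul_apply, map_sum, map_smul, hA, Finset.sum_mul, smul_mul_assoc]
    rw [hD, mul_apply_eq_comp]
  · intro hD p v
    refine h.eq_of_apply_eq (hΦ _) (fun i => (h.commute_left i p).mul_right (hΦ v i)) ?_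
    have span {P : V →L[𝕜] V} (hP : ∀ i, Commute (D i) P) : α (P (Φ v ξ)) = α (Φ (P v) ξ) := by
      rw [← h.symm.sum_smul_eq hP]
      simp only [sum_apply, smul_apply, map_sum, map_smul, hD]
    refine h.eq_of_forall_right fun i => ?_
    rw [← hD]
    exact (span fun j => (h.commute_right j i).mul_right (h.commute p j).symm).symm

lemma linearityDefect_comm_of_structure (h : IsDualPair A D ξ α) {c : ι → ι → ι → 𝕜}
    (hc : ∀ r l, A r * A l = ∑ s, c r l s • A s) {Γ : ι → ι → V →ₗ[𝕜] V →L[𝕜] V}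
    (hsym : ∀ p r l, linearityDefect (A p) (Γ r l) = linearityDefect (A r) (Γ p l))
    (hassoc : ∀ p r l v,
      A p * Γ r l v + ∑ s, c r l s • Γ p s v = A r * Γ p l v + ∑ s, c p l s • Γ r s v)
    {Ψ : ι → V →ₗ[𝕜] V →L[𝕜] V} (hcomm : ∀ r v i, Commute (A i) (Ψ r v))
    (hΨ : ∀ r l v, α (A l (Ψ r v ξ)) = -α (Γ r l v ξ)) (p r : ι) :
    linearityDefect (A p) (Ψ r) = linearityDefect (A r) (Ψ p) := by
  ext1 v
  have comm_defect (p r i : ι) : Commute (A i) (linearityDefect (A p) (Ψ r) v) :=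
    commute_linearityDefect (h.commute_left i p) (hcomm r · i) v
  refine h.eq_of_apply_eq (comm_defect p r) (comm_defect r p)
    (h.symm.eq_of_forall_right fun l => ?_)
  have pairing (p r : ι) : α (A l (linearityDefect (A p) (Ψ r) v ξ)) =
      ∑ s, c p l s * α (Γ r s v ξ) - α (Γ r l (A p v) ξ) := by
    have hmul : A l (A p (Ψ r v ξ)) = ∑ s, c p l s • A s (Ψ r v ξ) := by
      have := DFunLike.congr_fun (((h.commute_left l p).eq.trans (hc p l))) (Ψ r v ξ)
      simpa using this
    simp only [linearityDefect_apply, sub_apply, mul_apply_eq_comp, map_sub, hmul, map_sum,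
      map_smul, hΨ, smul_eq_mul, mul_neg, Finset.sum_neg_distrib]
    ring
  have hsym' := congrArg (fun Φ => α (Φ v ξ)) (hsym p r l)
  have hassoc' := congrArg (fun P => α (P ξ)) (hassoc p r l v)
  simp only [linearityDefect_apply, sub_apply, add_apply, mul_apply_eq_comp, sum_apply, smul_apply,
    map_sub, map_add, map_sum, map_smul, smul_eq_mul] at hsym' hassoc'
  rw [pairing, pairing]
  linear_combination -hsym' - hassoc'

end IsDualPair

end DualPair

section Calculus

variable {n : ℕ} {X : Type*} [TopologicalSpace X] [ChartedSpace (EuclideanSpace ℝ (Fin n)) X]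

lemma SmoothFunOn.mono {U V : Set X} {f : X → ℝ} (hf : SmoothFunOn n U f) (h : V ⊆ U) :
    SmoothFunOn n V f :=
  ContMDiffOn.mono hf h

lemma SmoothFunOn.mdifferentiableAt {U : Set X} {f : X → ℝ} (hf : SmoothFunOn n U f)
    (hU : IsOpen U) {x : X} (hx : x ∈ U) : MDifferentiableAt (𝓡 n) 𝓘(ℝ, ℝ) f x :=
  (ContMDiffOn.contMDiffAt hf (hU.mem_nhds hx)).mdifferentiableAt (by simp)

lemma smoothFunOn_linearCombination {ι : Type*} [Fintype ι] {U : Set X} (a : ι → ℝ)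
    {h : ι → X → ℝ} (hh : ∀ i, SmoothFunOn n U (h i)) :
    SmoothFunOn n U (fun x => ∑ s, a s * h s x) :=
  contMDiffOn_finsetSum fun s _ => ContMDiffOn.mul contMDiffOn_const (hh s)

lemma differential_congr {f g : X → ℝ} {x : X} (h : f =ᶠ[𝓝 x] g) :
    differential n f x = differential n g x := by
  have e : mfderiv (𝓡 n) 𝓘(ℝ, ℝ) f x = mfderiv (𝓡 n) 𝓘(ℝ, ℝ) g x := h.mfderiv_eq
  ext v
  exact congrArg (fun L : EuclideanSpace ℝ (Fin n) →L[ℝ] ℝ => L v) e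

lemma differential_const (c : ℝ) (x : X) : differential n (fun _ : X => c) x = 0 :=
  mvfderiv_const c

lemma differential_add {f g : X → ℝ} {x : X} (hf : MDifferentiableAt (𝓡 n) 𝓘(ℝ, ℝ) f x)
    (hg : MDifferentiableAt (𝓡 n) 𝓘(ℝ, ℝ) g x) :
    differential n (fun y => f y + g y) x = differential n f x + differential n g x :=
  mvfderiv_add hf hg

lemma differential_mul {f g : X → ℝ} {x : X} (hf : MDifferentiableAt (𝓡 n) 𝓘(ℝ, ℝ) f x)
    (hg : MDifferentiableAt (𝓡 n) 𝓘(ℝ, ℝ) g x) :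
    differential n (fun y => f y * g y) x =
      f x • differential n g x + g x • differential n f x := by
  have := mvfderiv_mul hf hg
  exact this

lemma differential_sum {ι : Type*} (s : Finset ι) {f : ι → X → ℝ} {x : X}
    (hf : ∀ i ∈ s, MDifferentiableAt (𝓡 n) 𝓘(ℝ, ℝ) (f i) x) :
    differential n (fun y => ∑ i ∈ s, f i y) x = ∑ i ∈ s, differential n (f i) x := by
  classical
  suffices h : MDifferentiableAt (𝓡 n) 𝓘(ℝ, ℝ) (fun y => ∑ i ∈ s, f i y) x ∧
      differential n (fun y => ∑ i ∈ s, f i y) x = ∑ i ∈ s, differential n (f i) x from h.2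
  induction s using Finset.induction_on with
  | empty => exact ⟨by simpa using mdifferentiableAt_const, by simpa using differential_const 0 x⟩
  | insert i s hi ih =>
    obtain ⟨hs, h⟩ := ih fun j hj => hf j (Finset.mem_insert_of_mem hj)
    have hfi := hf i (Finset.mem_insert_self i s)
    simp only [Finset.sum_insert hi]
    exact ⟨hfi.add hs, by rw [differential_add hfi hs, h]⟩

lemma differential_sum_mul {ι : Type*} [Fintype ι] {f g : ι → X → ℝ} {x : X}
    (hf : ∀ i, MDifferentiableAt (𝓡 n) 𝓘(ℝ, ℝ) (f i) x)
    (hg : ∀ i, MDifferentiableAt (𝓡 n) 𝓘(ℝ, ℝ) (g i) x) (v : TangentSpace (𝓡 n) x) :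
    differential n (fun y => ∑ i, f i y * g i y) x v =
      ∑ i, (f i x * differential n (g i) x v + g i x * differential n (f i) x v) := by
  rw [differential_sum (f := fun i y => f i y * g i y) _ fun i _ => (hf i).mul (hg i), sum_apply]
  refine Finset.sum_congr rfl fun i _ => ?_
  rw [differential_mul (hf i) (hg i)]
  rfl

lemma differential_linearCombination {ι : Type*} [Fintype ι] (a : ι → ℝ) {f : ι → X → ℝ} {x : X}
    (hf : ∀ i, MDifferentiableAt (𝓡 n) 𝓘(ℝ, ℝ) (f i) x) :
    differential n (fun y => ∑ i, a i * f i y) x = ∑ i, a i • differential n (f i) x := by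
  ext v
  rw [differential_sum_mul (f := fun i _ => a i) (fun _ => mdifferentiableAt_const) hf]
  simp [differential_const]

lemma bracket_swap (ξ η : VField n X) (x : X) : bracket ξ η x = -bracket η ξ x :=
  VectorField.mlieBracket_swap_apply

lemma bracket_self (ξ : VField n X) (x : X) : bracket ξ ξ x = 0 := by
  simp [bracket]

lemma bracket_zero_right (ξ : VField n X) (x : X) : bracket ξ (fun _ => 0) x = 0 :=
  congrFun (VectorField.mlieBracket_zero_right (I := 𝓡 n) (W := ξ)) x

variable [IsManifold (𝓡 n) ∞ X]

lemma SmoothVFieldOn.mono {U V : Set X} {ξ : VField n X} (hξ : SmoothVFieldOn U ξ) (h : V ⊆ U) :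
    SmoothVFieldOn V ξ :=
  ContMDiffOn.mono hξ h

lemma SmoothOpFieldOn.mono {U V : Set X} {L : OpField n X} (hL : SmoothOpFieldOn U L)
    (h : V ⊆ U) : SmoothOpFieldOn V L :=
  ContMDiffOn.mono hL h

lemma SmoothVFieldOn.mdifferentiableAt {U : Set X} {ξ : VField n X} (hξ : SmoothVFieldOn U ξ)
    (hU : IsOpen U) {x : X} (hx : x ∈ U) :
    MDifferentiableAt (𝓡 n) (𝓡 n).tangent (fun x => (⟨x, ξ x⟩ : TangentBundle (𝓡 n) X)) x :=
  (ContMDiffOn.contMDiffAt hξ (hU.mem_nhds hx)).mdifferentiableAt (by simp)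

lemma SmoothOpFieldOn.applyOp {U : Set X} {L : OpField n X} {ξ : VField n X}
    (hL : SmoothOpFieldOn U L) (hξ : SmoothVFieldOn U ξ) : SmoothVFieldOn U (applyOp L ξ) :=
  ContMDiffOn.clm_bundle_apply (E₁ := fun x : X => TangentSpace (𝓡 n) x)
    (E₂ := fun x : X => TangentSpace (𝓡 n) x) hL hξ

lemma SmoothVFieldOn.smul {U : Set X} {f : X → ℝ} {ξ : VField n X} (hf : SmoothFunOn n U f)
    (hξ : SmoothVFieldOn U ξ) : SmoothVFieldOn U (fun x => f x • ξ x) :=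
  ContMDiffOn.smul_section (V := fun x : X => TangentSpace (𝓡 n) x) hf hξ

lemma SmoothVFieldOn.add {U : Set X} {ξ η : VField n X} (hξ : SmoothVFieldOn U ξ)
    (hη : SmoothVFieldOn U η) : SmoothVFieldOn U (fun x => ξ x + η x) :=
  ContMDiffOn.add_section (V := fun x : X => TangentSpace (𝓡 n) x) hξ hη

lemma SmoothVFieldOn.sum {ι : Type*} {s : Finset ι} {U : Set X} {ξ : ι → VField n X}
    (hξ : ∀ i ∈ s, SmoothVFieldOn U (ξ i)) : SmoothVFieldOn U (fun x => ∑ i ∈ s, ξ i x) :=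
  ContMDiffOn.sum_section (V := fun x : X => TangentSpace (𝓡 n) x) hξ

lemma SmoothOpFieldOn.combination {U : Set X} {h : Fin n → X → ℝ} {K : Fin n → OpField n X}
    (hh : ∀ i, SmoothFunOn n U (h i)) (hK : ∀ i, SmoothOpFieldOn U (K i)) :
    SmoothOpFieldOn U (combination h K) :=
  ContMDiffOn.sum_section (V := fun x : X => TangentSpace (𝓡 n) x →L[ℝ] TangentSpace (𝓡 n) x)
    fun i _ => ContMDiffOn.smul_section
      (V := fun x : X => TangentSpace (𝓡 n) x →L[ℝ] TangentSpace (𝓡 n) x) (hh i) (hK i)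

lemma exists_smoothVFieldOn_eq {U : Set X} (hU : IsOpen U) {x : X} (hx : x ∈ U)
    (v : TangentSpace (𝓡 n) x) :
    ∃ V : Set X, IsOpen V ∧ x ∈ V ∧ V ⊆ U ∧ ∃ ξ : VField n X, SmoothVFieldOn V ξ ∧ ξ x = v := by
  obtain ⟨s, hs, h⟩ := FiberBundle.exists_contMDiffOn_extend (k := ∞) (𝓡 n)
    (EuclideanSpace ℝ (Fin n)) (V := fun x : X => TangentSpace (𝓡 n) x) v
  obtain ⟨t, hts, ht, hxt⟩ := mem_nhds_iff.1 hs
  refine ⟨t ∩ U, ht.inter hU, ⟨hxt, hx⟩, inter_subset_right, _,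
    ContMDiffOn.mono h (inter_subset_left.trans hts), ?_⟩
  simp

variable {U : Set X}

lemma bracket_add_right (hU : IsOpen U) {ξ η ζ : VField n X} (hη : SmoothVFieldOn U η)
    (hζ : SmoothVFieldOn U ζ) {x : X} (hx : x ∈ U) :
    bracket ξ (fun y => η y + ζ y) x = bracket ξ η x + bracket ξ ζ x :=
  VectorField.mlieBracket_add_right (hη.mdifferentiableAt hU hx) (hζ.mdifferentiableAt hU hx)

lemma bracket_add_left (hU : IsOpen U) {ξ η ζ : VField n X} (hξ : SmoothVFieldOn U ξ)
    (hη : SmoothVFieldOn U η) {x : X} (hx : x ∈ U) :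
    bracket (fun y => ξ y + η y) ζ x = bracket ξ ζ x + bracket η ζ x :=
  VectorField.mlieBracket_add_left (hξ.mdifferentiableAt hU hx) (hη.mdifferentiableAt hU hx)

lemma bracket_smul_right (hU : IsOpen U) {f : X → ℝ} {ξ η : VField n X} (hf : SmoothFunOn n U f)
    (hη : SmoothVFieldOn U η) {x : X} (hx : x ∈ U) :
    bracket ξ (fun y => f y • η y) x = differential n f x (ξ x) • η x + f x • bracket ξ η x :=
  VectorField.mlieBracket_smul_right (hf.mdifferentiableAt hU hx) (hη.mdifferentiableAt hU hx)

lemma bracket_sum_right {ι : Type*} (s : Finset ι) (hU : IsOpen U) {ξ : VField n X}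
    {η : ι → VField n X} (hη : ∀ i ∈ s, SmoothVFieldOn U (η i)) {x : X} (hx : x ∈ U) :
    bracket ξ (fun y => ∑ i ∈ s, η i y) x = ∑ i ∈ s, bracket ξ (η i) x := by
  classical
  induction s using Finset.induction_on with
  | empty => simpa using bracket_zero_right ξ x
  | insert i s hi ih =>
    have hs : ∀ j ∈ s, SmoothVFieldOn U (η j) := fun j hj => hη j (Finset.mem_insert_of_mem hj)
    simp only [Finset.sum_insert hi]
    rw [bracket_add_right hU (hη i (Finset.mem_insert_self i s)) (SmoothVFieldOn.sum hs) hx, ih hs]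

end Calculus

section MovingFrame

variable {E H M : Type*} [NormedAddCommGroup E] [NormedSpace ℝ E] [TopologicalSpace H]
  {I : ModelWithCorners ℝ E H} [TopologicalSpace M] [ChartedSpace H M] {k : WithTop ℕ∞}
  {F : Type*} [NormedAddCommGroup F] [NormedSpace ℝ F]

lemma contMDiffAt_of_clm_apply_eq {G : Type*} [NormedAddCommGroup G] [NormedSpace ℝ G]
    [CompleteSpace G] {P : M → G →L[ℝ] F} {c : M → G} {w : M → F} {x : M}
    (hP : ContMDiffAt I 𝓘(ℝ, G →L[ℝ] F) k P x) (hw : ContMDiffAt I 𝓘(ℝ, F) k w x)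
    (hx : (P x).IsInvertible) (h : ∀ᶠ y in 𝓝 x, P y (c y) = w y) :
    ContMDiffAt I 𝓘(ℝ, G) k c x := by
  have hinv : ContMDiffAt I 𝓘(ℝ, F →L[ℝ] G) k (fun y => (P y).inverse) x :=
    hx.contDiffAt_map_inverse.contMDiffAt.comp x hP
  refine (hinv.clm_apply hw).congr_of_eventuallyEq ?_
  have hev : ∀ᶠ y in 𝓝 x, (P y).IsInvertible := by
    obtain ⟨e, he⟩ := hx
    exact hP.continuousAt.eventually (he ▸ ContinuousLinearEquiv.nhds e)
  filter_upwards [h, hev] with y hy hyinv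
  rw [← hy, hyinv.inverse_apply_self]

lemma contMDiffAt_of_sum_smul_eq {ι : Type*} [Fintype ι] [FiniteDimensional ℝ F]
    (hF : Fintype.card ι = Module.finrank ℝ F) {g : ι → M → F} {w : M → F} {c : M → ι → ℝ} {x : M}
    (hg : ∀ i, ContMDiffAt I 𝓘(ℝ, F) k (g i) x) (hw : ContMDiffAt I 𝓘(ℝ, F) k w x)
    (h : ∀ᶠ y in 𝓝 x, ∑ i, c y i • g i y = w y) (hx : LinearIndependent ℝ fun i => g i x) :
    ContMDiffAt I 𝓘(ℝ, ι → ℝ) k c x := by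
  set P : M → (ι → ℝ) →L[ℝ] F := fun y =>
    ∑ i, (ContinuousLinearMap.proj (R := ℝ) (φ := fun _ : ι => ℝ) i).smulRight (g i y) with hP
  have P_apply (y : M) (v : ι → ℝ) : P y v = ∑ i, v i • g i y := by simp [hP]
  have P_smooth : ContMDiffAt I 𝓘(ℝ, (ι → ℝ) →L[ℝ] F) k P x :=
    ContMDiffAt.sum fun i _ => (ContinuousLinearMap.smulRightL ℝ (ι → ℝ) F
      (ContinuousLinearMap.proj i)).contDiff.contMDiff.contMDiffAt.comp x (hg i)
  have P_injective : Function.Injective (P x : (ι → ℝ) →ₗ[ℝ] F) :=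
    (injective_iff_map_eq_zero _).2 fun v hv =>
      funext (Fintype.linearIndependent_iff.1 hx v ((P_apply x v).symm.trans hv))
  refine contMDiffAt_of_clm_apply_eq P_smooth hw ?_ (by simpa only [P_apply] using h)
  exact ⟨(LinearEquiv.ofInjectiveOfFinrankEq (P x : (ι → ℝ) →ₗ[ℝ] F) P_injective
    (by simp [hF])).toContinuousLinearEquiv, rfl⟩

variable {n : ℕ} {X : Type*} [TopologicalSpace X] [ChartedSpace (EuclideanSpace ℝ (Fin n)) X]

instance finiteDimensional_tangentSpace (x : X) : FiniteDimensional ℝ (TangentSpace (𝓡 n) x) :=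
  inferInstanceAs (FiniteDimensional ℝ (EuclideanSpace ℝ (Fin n)))

lemma finrank_tangentSpace (x : X) : Module.finrank ℝ (TangentSpace (𝓡 n) x) = n :=
  finrank_euclideanSpace_fin (𝕜 := ℝ)

variable [IsManifold (𝓡 n) ∞ X]

lemma SmoothVFieldOn.contMDiffAt_of_sum_smul_eq {U : Set X} (hU : IsOpen U)
    {ξ : Fin n → VField n X} {η : VField n X} (hξ : ∀ i, SmoothVFieldOn U (ξ i))
    (hη : SmoothVFieldOn U η) {c : X → Fin n → ℝ} (h : ∀ y ∈ U, ∑ i, c y i • ξ i y = η y) {x : X}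
    (hx : x ∈ U) (hind : LinearIndependent ℝ fun i => ξ i x) :
    ContMDiffAt (𝓡 n) 𝓘(ℝ, Fin n → ℝ) ∞ c x := by
  set t := trivializationAt (EuclideanSpace ℝ (Fin n)) (fun x : X => TangentSpace (𝓡 n) x) x
  have hxt : x ∈ t.baseSet := FiberBundle.mem_baseSet_trivializationAt' x
  have smooth_coord {ζ : VField n X} (hζ : SmoothVFieldOn U ζ) :
      ContMDiffAt (𝓡 n) 𝓘(ℝ, EuclideanSpace ℝ (Fin n)) ∞ (fun y => (t ⟨y, ζ y⟩).2) x :=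
    (contMDiffAt_section (E := fun x : X => TangentSpace (𝓡 n) x) x).1
      (ContMDiffOn.contMDiffAt hζ (hU.mem_nhds hx))
  have coord_eq {y : X} (hy : y ∈ t.baseSet) (v : TangentSpace (𝓡 n) y) :
      (t ⟨y, v⟩).2 = t.linearEquivAt ℝ y hy v := rfl
  refine OperatorFrobenius.contMDiffAt_of_sum_smul_eq (by simp) (fun i => smooth_coord (hξ i))
    (smooth_coord hη) ?_ ?_
  · filter_upwards [hU.mem_nhds hx, t.open_baseSet.mem_nhds hxt] with y hy hyt
    simp only [coord_eq hyt, ← h y hy, map_sum, map_smul]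
  · simp only [coord_eq hxt]
    exact hind.map' _ (t.linearEquivAt ℝ x hxt).ker

end MovingFrame

section BracketTensor

variable {n : ℕ} {X : Type*} [TopologicalSpace X] [ChartedSpace (EuclideanSpace ℝ (Fin n)) X]

lemma commute_combination {L : OpField n X} {g : Fin n → X → ℝ} {K : Fin n → OpField n X} {x : X}
    (h : ∀ j, (L x).comp (K j x) = (K j x).comp (L x)) :
    (L x).comp (combination g K x) = (combination g K x).comp (L x) :=
  Commute.sum_right _ _ _ fun j _ => Commute.smul_right (h j) _

lemma bracketTensor_swap {L N : OpField n X} {x : X} (h : (L x).comp (N x) = (N x).comp (L x))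
    (ξ η : VField n X) : bracketTensor L N ξ η x = -bracketTensor N L η ξ x := by
  have h1 : L x (N x (bracket η ξ x)) = N x (L x (bracket η ξ x)) :=
    DFunLike.congr_fun h (bracket η ξ x)
  simp only [bracketTensor]
  rw [bracket_swap ξ η, bracket_swap (applyOp L ξ) (applyOp N η), bracket_swap ξ (applyOp N η),
    bracket_swap (applyOp L ξ) η]
  simp only [map_neg, h1]
  abel

lemma bracketTensor_comp {L N P : OpField n X} {x : X}
    (h : (L x).comp (N x) = (N x).comp (L x)) (ξ : VField n X) :
    bracketTensor L (fun y => (N y).comp (P y)) ξ ξ x =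
      bracketTensor L N ξ (applyOp P ξ) x + N x (bracketTensor L P ξ ξ x) := by
  have h1 (v : TangentSpace (𝓡 n) x) : L x (N x v) = N x (L x v) := DFunLike.congr_fun h v
  have h2 : applyOp (fun y => (N y).comp (P y)) ξ = applyOp N (applyOp P ξ) := rfl
  simp only [bracketTensor, h2, map_add, map_sub, bracket_self, map_zero, h1,
    ContinuousLinearMap.comp_apply]
  abel

/-- The covariant derivative `v ↦ ∇_v (∑ g k • K k)` at `x` with respect to the connection on the
span of the `K k` for which they are parallel. It turns the symmetry conditions on `∑ g k • K k`
into pointwise algebra. -/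
noncomputable def frameDeriv (K : Fin n → OpField n X) (g : Fin n → X → ℝ) (x : X) :
    TangentSpace (𝓡 n) x →ₗ[ℝ] TangentSpace (𝓡 n) x →L[ℝ] TangentSpace (𝓡 n) x :=
  ∑ k, (differential n (g k) x : TangentSpace (𝓡 n) x →ₗ[ℝ] ℝ).smulRight (K k x)

lemma frameDeriv_apply (K : Fin n → OpField n X) (g : Fin n → X → ℝ) (x : X)
    (v : TangentSpace (𝓡 n) x) :
    frameDeriv K g x v = ∑ k, differential n (g k) x v • K k x := by
  simp [frameDeriv]

variable [IsManifold (𝓡 n) ∞ X] {U : Set X}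

lemma bracketTensor_add_add {L N : OpField n X} (hU : IsOpen U) (hL : SmoothOpFieldOn U L)
    (hN : SmoothOpFieldOn U N) {ξ η : VField n X} (hξ : SmoothVFieldOn U ξ)
    (hη : SmoothVFieldOn U η) {x : X} (hx : x ∈ U) :
    bracketTensor L N (fun y => ξ y + η y) (fun y => ξ y + η y) x =
      bracketTensor L N ξ ξ x + bracketTensor L N ξ η x + bracketTensor L N η ξ x +
        bracketTensor L N η η x := by
  have e (A : OpField n X) : applyOp A (fun y => ξ y + η y) =
      fun y => applyOp A ξ y + applyOp A η y := by
    funext y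
    simp [applyOp]
  simp only [bracketTensor, e]
  rw [bracket_add_left hU hξ hη hx, bracket_add_left hU hξ hη hx,
    bracket_add_left hU (hL.applyOp hξ) (hL.applyOp hη) hx,
    bracket_add_left hU (hL.applyOp hξ) (hL.applyOp hη) hx,
    bracket_add_right hU hξ hη hx, bracket_add_right hU hξ hη hx,
    bracket_add_right hU hξ hη hx, bracket_add_right hU hξ hη hx,
    bracket_add_right hU (hN.applyOp hξ) (hN.applyOp hη) hx,
    bracket_add_right hU (hN.applyOp hξ) (hN.applyOp hη) hx,
    bracket_add_right hU (hN.applyOp hξ) (hN.applyOp hη) hx,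
    bracket_add_right hU (hN.applyOp hξ) (hN.applyOp hη) hx]
  simp only [map_add]
  abel

lemma isSymmetryOn_iff_bracketTensor_self {L N : OpField n X} (hL : SmoothOpFieldOn U L)
    (hN : SmoothOpFieldOn U N) (hc : ∀ x ∈ U, (L x).comp (N x) = (N x).comp (L x)) :
    IsSymmetryOn U L N ↔ ∀ V : Set X, IsOpen V → V ⊆ U → ∀ ξ : VField n X, SmoothVFieldOn V ξ →
      ∀ x ∈ V, bracketTensor L N ξ ξ x = 0 := by
  constructor
  · intro h V hV hVU ξ hξ x hx
    have h2 := h.symm_part V hV hVU ξ ξ hξ hξ x hx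
    rw [← two_smul ℝ] at h2
    exact (smul_eq_zero.1 h2).resolve_left two_ne_zero
  · refine fun h => ⟨hL, hN, hc, fun V hV hVU ξ η hξ hη x hx => ?_⟩
    have h2 := h V hV hVU _ (hξ.add hη) x hx
    rw [bracketTensor_add_add hV (hL.mono hVU) (hN.mono hVU) hξ hη hx, h V hV hVU ξ hξ x hx,
      h V hV hVU η hη x hx] at h2
    simpa using h2

lemma IsSymmetryOn.bracketTensor_self {L N : OpField n X} (h : IsSymmetryOn U L N) {V : Set X}
    (hV : IsOpen V) (hVU : V ⊆ U) {ξ : VField n X} (hξ : SmoothVFieldOn V ξ) {x : X}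
    (hx : x ∈ V) : bracketTensor L N ξ ξ x = 0 :=
  (isSymmetryOn_iff_bracketTensor_self h.smooth_left h.smooth_right h.commute).1 h
    V hV hVU ξ hξ x hx

lemma bracketTensor_combination {L : OpField n X} {g : Fin n → X → ℝ} {K : Fin n → OpField n X}
    (hU : IsOpen U) (hg : ∀ i, SmoothFunOn n U (g i)) (hK : ∀ i, SmoothOpFieldOn U (K i))
    {ξ : VField n X} (hξ : SmoothVFieldOn U ξ) {x : X} (hx : x ∈ U) :
    bracketTensor L (combination g K) ξ ξ x =
      ∑ j, g j x • bracketTensor L (K j) ξ ξ x +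
        linearityDefect (L x) (frameDeriv K g x) (ξ x) (ξ x) := by
  have combination_apply :
      applyOp (combination g K) ξ = fun y => ∑ j, g j y • applyOp (K j) ξ y := by
    funext y
    simp [applyOp, combination]
  have hs (j : Fin n) : SmoothVFieldOn U (applyOp (K j) ξ) := (hK j).applyOp hξ
  have leibniz (η : VField n X) : bracket η (applyOp (combination g K) ξ) x =
      frameDeriv K g x (η x) (ξ x) + ∑ j, g j x • bracket η (applyOp (K j) ξ) x := by
    rw [combination_apply, bracket_sum_right _ hU (fun j _ => (hs j).smul (hg j)) hx,
      frameDeriv_apply, sum_apply, ← Finset.sum_add_distrib]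
    exact Finset.sum_congr rfl fun j _ => bracket_smul_right hU (hg j) (hs j) hx
  have bracket_combination : combination g K x (bracket (applyOp L ξ) ξ x) =
      ∑ j, g j x • K j x (bracket (applyOp L ξ) ξ x) := by
    simp [combination]
  simp only [bracketTensor, leibniz, bracket_combination, bracket_self, map_zero, zero_add, map_add,
    map_sum, map_smul, smul_sub, Finset.sum_sub_distrib]
  simp only [applyOp, linearityDefect_apply, sub_apply, mul_apply_eq_comp]
  abel

lemma IsSymmetryOn.bracketTensor_combination {L : OpField n X} {g : Fin n → X → ℝ}
    {K : Fin n → OpField n X} (hsym : ∀ j, IsSymmetryOn U L (K j)) {V : Set X}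
    (hV : IsOpen V) (hVU : V ⊆ U) (hg : ∀ i, SmoothFunOn n V (g i))
    {ξ : VField n X} (hξ : SmoothVFieldOn V ξ) {x : X} (hx : x ∈ V) :
    bracketTensor L (combination g K) ξ ξ x =
      linearityDefect (L x) (frameDeriv K g x) (ξ x) (ξ x) := by
  rw [OperatorFrobenius.bracketTensor_combination hV hg
    (fun j => (hsym j).smooth_right.mono hVU) hξ hx, add_eq_right]
  exact Finset.sum_eq_zero fun j _ => by rw [(hsym j).bracketTensor_self hV hVU hξ hx, smul_zero]

lemma isSymmetryOn_combination_iff {L : OpField n X} {g : Fin n → X → ℝ} {K : Fin n → OpField n X}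
    (hU : IsOpen U) (hL : SmoothOpFieldOn U L) (hsym : ∀ j, IsSymmetryOn U L (K j))
    (hg : ∀ i, SmoothFunOn n U (g i)) :
    IsSymmetryOn U L (combination g K) ↔
      ∀ x ∈ U, ∀ v, linearityDefect (L x) (frameDeriv K g x) v v = 0 := by
  rw [isSymmetryOn_iff_bracketTensor_self hL (.combination hg fun j => (hsym j).smooth_right)
    fun x hx => commute_combination fun j => (hsym j).commute x hx]
  constructor
  · intro h x hx v
    obtain ⟨V, hV, hxV, hVU, ξ, hξ, rfl⟩ := exists_smoothVFieldOn_eq hU hx v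
    have := h V hV hVU ξ hξ x hxV
    rwa [IsSymmetryOn.bracketTensor_combination hsym hV hVU (fun i => (hg i).mono hVU) hξ hxV]
      at this
  · intro h V hV hVU ξ hξ x hx
    rw [IsSymmetryOn.bracketTensor_combination hsym hV hVU (fun i => (hg i).mono hVU) hξ hx,
      h x (hVU hx)]

lemma MutualSymmetriesOn.bracketTensor_combination_combination {K : Fin n → OpField n X}
    (hsym : MutualSymmetriesOn U K) {V : Set X} (hV : IsOpen V) (hVU : V ⊆ U) {f g : Fin n → X → ℝ}
    (hf : ∀ i, SmoothFunOn n V (f i)) (hg : ∀ i, SmoothFunOn n V (g i)) {ξ : VField n X}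
    (hξ : SmoothVFieldOn V ξ) {x : X} (hx : x ∈ V) :
    bracketTensor (combination f K) (combination g K) ξ ξ x =
      linearityDefect (combination f K x) (frameDeriv K g x) (ξ x) (ξ x) -
        linearityDefect (combination g K x) (frameDeriv K f x) (ξ x) (ξ x) := by
  have swap (j : Fin n) : bracketTensor (combination f K) (K j) ξ ξ x =
      -linearityDefect (K j x) (frameDeriv K f x) (ξ x) (ξ x) := by
    rw [bracketTensor_swap, IsSymmetryOn.bracketTensor_combination (hsym j) hV hVU hf hξ hx]
    exact (commute_combination fun i => (hsym j i).commute x (hVU hx)).symm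
  rw [bracketTensor_combination hV hg (fun j => (hsym j j).smooth_left.mono hVU) hξ hx, add_comm,
    sub_eq_add_neg (linearityDefect _ _ _ _)]
  simp only [swap, linearityDefect_apply, smul_neg, smul_sub, Finset.sum_neg_distrib,
    Finset.sum_sub_distrib, sub_apply, mul_apply_eq_comp]
  simp [combination]

end BracketTensor

section FrobeniusAlgebra

variable {n : ℕ} {X : Type*} [TopologicalSpace X] [ChartedSpace (EuclideanSpace ℝ (Fin n)) X]
  [IsManifold (𝓡 n) ∞ X] {K : Fin n → OpField n X} {a : Fin n → ℝ}

namespace IsOperatorFrobeniusAlgebra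

lemma exists_isDualPair (hK : IsOperatorFrobeniusAlgebra K) (x : X) :
    ∃ (D : Fin n → TangentSpace (𝓡 n) x →L[ℝ] TangentSpace (𝓡 n) x) (ξ : TangentSpace (𝓡 n) x)
      (α : TangentSpace (𝓡 n) x →ₗ[ℝ] ℝ), IsDualPair (K · x) D ξ α := by
  obtain ⟨ξ, hξ⟩ := hK.exists_generic_vector x
  obtain ⟨α, hα⟩ := hK.exists_generic_covector x
  refine ⟨_, ξ, α, .of_linearIndependent (hK.commute · · x) ?_ hξ ?_⟩
  · rw [finrank_tangentSpace, Fintype.card_fin]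
  · exact hα.map' (ContinuousLinearMap.coeLM ℝ)
      (LinearMap.ker_eq_bot.2 ContinuousLinearMap.coe_injective)

variable (hK : IsOperatorFrobeniusAlgebra K)
include hK

lemma comp_eq_sum_structureFun (x : X) (i j : Fin n) :
    (K i x).comp (K j x) = ∑ k, structureFun K i j x k • K k x := by
  obtain ⟨D, ξ, α, h⟩ := hK.exists_isDualPair x
  have hcomm (l : Fin n) : Commute (K l x) (K i x * K j x) :=
    (h.commute_left l i).mul_right (h.commute_left l j)
  exact Classical.epsilon_spec (p := fun c : Fin n → ℝ => (K i x).comp (K j x) = ∑ k, c k • K k x)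
    ⟨_, (h.sum_smul_eq hcomm).symm⟩

lemma frobeniusForm_apply {x : X} {ξ : TangentSpace (𝓡 n) x} {α : TangentSpace (𝓡 n) x →ₗ[ℝ] ℝ}
    (hα : ∀ k, α (K k x ξ) = a k) (i j : Fin n) :
    frobeniusForm K a x i j = α (K i x (K j x ξ)) := by
  have := congrArg α (DFunLike.congr_fun (hK.comp_eq_sum_structureFun x i j) ξ)
  simpa [frobeniusForm, hα] using this.symm

lemma exists_isDualPair_dualBasis {x : X} (ha : (frobeniusForm K a x).det ≠ 0) :
    ∃ (ξ : TangentSpace (𝓡 n) x) (α : TangentSpace (𝓡 n) x →ₗ[ℝ] ℝ),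
      (∀ k, α (K k x ξ) = a k) ∧ IsDualPair (K · x) (dualBasis K a · x) ξ α := by
  obtain ⟨D, ξ, α, h⟩ := hK.exists_isDualPair x
  have hα (k : Fin n) :
      (∑ i, a i • α ∘ₗ (D i : TangentSpace (𝓡 n) x →ₗ[ℝ] TangentSpace (𝓡 n) x)) (K k x ξ) =
        a k := by
    simp [h.dual]
  exact ⟨ξ, _, hα, .of_inv h.commute_left h.finrank_eq (hK.frobeniusForm_apply hα) ha⟩

lemma smoothFunOn_structureFun (i j k : Fin n) :
    SmoothFunOn n univ (fun x => structureFun K i j x k) := by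
  intro x _
  obtain ⟨v, hv⟩ := hK.exists_generic_vector x
  obtain ⟨V, hV, hxV, -, ξ, hξ, rfl⟩ := exists_smoothVFieldOn_eq isOpen_univ (mem_univ x) v
  have hs (i : Fin n) : SmoothOpFieldOn V (K i) := (hK.smooth i).mono (subset_univ V)
  have hc : ContMDiffAt (𝓡 n) 𝓘(ℝ, Fin n → ℝ) ∞ (structureFun K i j) x :=
    SmoothVFieldOn.contMDiffAt_of_sum_smul_eq hV (fun l => (hs l).applyOp hξ)
      ((hs i).applyOp ((hs j).applyOp hξ))
      (fun y _ => by
        simpa [applyOp] using (DFunLike.congr_fun (hK.comp_eq_sum_structureFun y i j) (ξ y)).symm)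
      hxV hv
  exact (contMDiffAt_pi_space.1 hc k).contMDiffWithinAt

lemma smoothFunOn_frobeniusForm (i j : Fin n) :
    SmoothFunOn n univ (fun x => frobeniusForm K a x i j) := by
  simp only [frobeniusForm, Matrix.of_apply, mul_comm _ (a _)]
  exact smoothFunOn_linearCombination a (hK.smoothFunOn_structureFun i j)

lemma smoothFunOn_frobeniusForm_inv (ha : ∀ x, (frobeniusForm K a x).det ≠ 0) (i j : Fin n) :
    SmoothFunOn n univ (fun x => (frobeniusForm K a x)⁻¹ i j) := by
  intro x _
  have hrow : ContMDiffAt (𝓡 n) 𝓘(ℝ, Fin n → ℝ) ∞ (fun y => (frobeniusForm K a y)⁻¹ i) x := by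
    refine contMDiffAt_of_sum_smul_eq (by simp) (g := fun l y => frobeniusForm K a y l)
      (w := fun _ => (1 : Matrix (Fin n) (Fin n) ℝ) i) (fun l => ?_) contMDiffAt_const
      (.of_forall fun y => ?_) (Matrix.linearIndependent_rows_of_det_ne_zero (ha x))
    · exact contMDiffAt_pi_space.2 fun m =>
        ContMDiffOn.contMDiffAt (hK.smoothFunOn_frobeniusForm l m) Filter.univ_mem
    · rw [← Matrix.nonsing_inv_mul _ (ha y).isUnit]
      ext m
      simp [Matrix.mul_apply]
  exact (contMDiffAt_pi_space.1 hrow j).contMDiffWithinAt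

lemma smoothOpFieldOn_dualBasis (ha : ∀ x, (frobeniusForm K a x).det ≠ 0) (i : Fin n) :
    SmoothOpFieldOn univ (dualBasis K a i) :=
  .combination (hK.smoothFunOn_frobeniusForm_inv ha i) hK.smooth

end IsOperatorFrobeniusAlgebra

end FrobeniusAlgebra

section CommonSymmetries

variable {n : ℕ} {X : Type*} [TopologicalSpace X] [ChartedSpace (EuclideanSpace ℝ (Fin n)) X]
  {K : Fin n → OpField n X}

lemma commute_frameDeriv {x : X} {P : TangentSpace (𝓡 n) x →L[ℝ] TangentSpace (𝓡 n) x}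
    (hP : ∀ k, Commute P (K k x)) (g : Fin n → X → ℝ) (v : TangentSpace (𝓡 n) x) :
    Commute P (frameDeriv K g x v) := by
  rw [frameDeriv_apply]
  exact .sum_right _ _ _ fun k _ => (hP k).smul_right _

variable [IsManifold (𝓡 n) ∞ X] {U : Set X} {a : Fin n → ℝ} {h : Fin n → X → ℝ}

lemma IsSymmetryOn.mono {L N : OpField n X} (hLN : IsSymmetryOn U L N) {V : Set X} (hVU : V ⊆ U) :
    IsSymmetryOn V L N where
  smooth_left := hLN.smooth_left.mono hVU
  smooth_right := hLN.smooth_right.mono hVU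
  commute x hx := hLN.commute x (hVU hx)
  symm_part W hW hWV := hLN.symm_part W hW (hWV.trans hVU)

lemma isCommonSymmetryOn_combination_iff_linearityDefect (hK : IsOperatorFrobeniusAlgebra K)
    (hsym : MutualSymmetriesOn univ K) (hU : IsOpen U) (hh : ∀ i, SmoothFunOn n U (h i)) :
    IsCommonSymmetryOn U K (combination h K) ↔
      ∀ x ∈ U, ∀ i, linearityDefect (K i x) (frameDeriv K h x) = 0 := by
  have hKi (i : Fin n) : IsSymmetryOn U (K i) (combination h K) ↔
      ∀ x ∈ U, linearityDefect (K i x) (frameDeriv K h x) = 0 := by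
    rw [isSymmetryOn_combination_iff hU ((hK.smooth i).mono (subset_univ U))
      (fun j => (hsym i j).mono (subset_univ U)) hh]
    refine forall₂_congr fun x _ => ⟨fun hself => ?_, fun h0 v => by rw [h0]; rfl⟩
    obtain ⟨D, ξ, α, hD⟩ := hK.exists_isDualPair x
    exact hD.eq_zero_of_forall_self (fun v j => commute_linearityDefect (hK.commute j i x)
      (commute_frameDeriv (hK.commute j · x) h) v) hself
  simp only [IsCommonSymmetryOn, hKi]
  exact ⟨fun H x hx i => H i x hx, fun H i x hx => H x hx i⟩

lemma isCommonSymmetryOn_combination_iff_pullForm (hK : IsOperatorFrobeniusAlgebra K)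
    (ha : ∀ x, (frobeniusForm K a x).det ≠ 0) (hsym : MutualSymmetriesOn univ K) (hU : IsOpen U)
    (hh : ∀ i, SmoothFunOn n U (h i)) :
    IsCommonSymmetryOn U K (combination h K) ↔
      ∀ i, ∀ x ∈ U, pullForm (dualBasis K a i) (differential n fun y => ∑ s, a s * h s y) x =
        differential n (h i) x := by
  rw [isCommonSymmetryOn_combination_iff_linearityDefect hK hsym hU hh, forall_comm]
  simp only [forall_comm (α := Fin n)]
  refine forall₂_congr fun x hx => ?_
  obtain ⟨ξ, α, hα, hD⟩ := hK.exists_isDualPair_dualBasis (ha x)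
  have apply_deriv (v : TangentSpace (𝓡 n) x) :
      α (frameDeriv K h x v ξ) = differential n (fun y => ∑ s, a s * h s y) x v := by
    rw [differential_linearCombination a fun i => (hh i).mdifferentiableAt hU hx, frameDeriv_apply]
    simp [hα, mul_comm]
  have apply_dual_deriv (i : Fin n) (v : TangentSpace (𝓡 n) x) :
      α (dualBasis K a i x (frameDeriv K h x v ξ)) = differential n (h i) x v := by
    rw [frameDeriv_apply]
    simp [hD.dual]
  rw [hD.forall_linearityDefect_eq_zero_iff
    (fun v j => commute_frameDeriv (hK.commute j · x) h v)]
  simp only [apply_deriv, apply_dual_deriv, ContinuousLinearMap.ext_iff, pullForm,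
    ContinuousLinearMap.comp_apply]

end CommonSymmetries

section DualSymmetries

variable {n : ℕ} {X : Type*} [TopologicalSpace X] [ChartedSpace (EuclideanSpace ℝ (Fin n)) X]

lemma differential_matrix_inv {ι : Type*} [Fintype ι] [DecidableEq ι] {B : X → Matrix ι ι ℝ} {x : X}
    (hB : ∀ i j, MDifferentiableAt (𝓡 n) 𝓘(ℝ, ℝ) (fun y => B y i j) x)
    (hC : ∀ i j, MDifferentiableAt (𝓡 n) 𝓘(ℝ, ℝ) (fun y => (B y)⁻¹ i j) x)
    (hdet : ∀ y, (B y).det ≠ 0) (v : TangentSpace (𝓡 n) x) :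
    (Matrix.of fun i j => differential n (fun y => (B y)⁻¹ i j) x v) =
      -((B x)⁻¹ * (Matrix.of fun i j => differential n (fun y => B y i j) x v) * (B x)⁻¹) := by
  set dB : Matrix ι ι ℝ := .of fun i j => differential n (fun y => B y i j) x v with hdB
  set dC : Matrix ι ι ℝ := .of fun i j => differential n (fun y => (B y)⁻¹ i j) x v with hdC
  have leibniz : (B x)⁻¹ * dB + dC * B x = 0 := by
    ext i j
    have hone : (fun y => ∑ k, (B y)⁻¹ i k * B y k j) = fun _ => (1 : Matrix ι ι ℝ) i j := by
      funext y
      rw [← Matrix.mul_apply, Matrix.nonsing_inv_mul _ (hdet y).isUnit]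
    have h0 := differential_sum_mul (hC i) (hB · j) v
    rw [hone, differential_const, Finset.sum_add_distrib] at h0
    simpa [Matrix.mul_apply, hdB, hdC, mul_comm] using h0.symm
  rw [eq_neg_of_add_eq_zero_left leibniz, neg_mul, neg_neg, mul_assoc,
    Matrix.mul_nonsing_inv _ (hdet x).isUnit, mul_one]

/-- The operator that represents with respect to the form `b_a` minus the derivative along `v` of
the row `r` of the matrix `(b_{ij})`. The sign is that of the derivative of an inverse matrix. -/
noncomputable def frobeniusFormDeriv (K : Fin n → OpField n X) (a : Fin n → ℝ) (x : X) (r : Fin n) :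
    TangentSpace (𝓡 n) x →ₗ[ℝ] TangentSpace (𝓡 n) x →L[ℝ] TangentSpace (𝓡 n) x :=
  -∑ q, (differential n (fun y => frobeniusForm K a y r q) x :
    TangentSpace (𝓡 n) x →ₗ[ℝ] ℝ).smulRight (dualBasis K a q x)

lemma frobeniusFormDeriv_apply (K : Fin n → OpField n X) (a : Fin n → ℝ) (x : X) (r : Fin n)
    (v : TangentSpace (𝓡 n) x) : frobeniusFormDeriv K a x r v =
      -∑ q, differential n (fun y => frobeniusForm K a y r q) x v • dualBasis K a q x := by
  simp [frobeniusFormDeriv]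

variable [IsManifold (𝓡 n) ∞ X] {K : Fin n → OpField n X} {a : Fin n → ℝ}

namespace IsOperatorFrobeniusAlgebra

variable (hK : IsOperatorFrobeniusAlgebra K)
include hK

lemma structureFun_assoc (x : X) (p r l k : Fin n) :
    ∑ s, structureFun K r l x s * structureFun K p s x k =
      ∑ s, structureFun K p l x s * structureFun K r s x k := by
  obtain ⟨D, ξ, α, h⟩ := hK.exists_isDualPair x
  have coeff (p r : Fin n) : α (D k (K p x (K r x (K l x ξ)))) =
      ∑ s, structureFun K r l x s * structureFun K p s x k := by
    have hmul (i j : Fin n) : K i x (K j x ξ) = ∑ s, structureFun K i j x s • K s x ξ := by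
      simpa using DFunLike.congr_fun (hK.comp_eq_sum_structureFun x i j) ξ
    simp only [hmul r l, map_sum, map_smul, hmul p, smul_eq_mul, h.dual, mul_ite, mul_one, mul_zero,
      Finset.sum_ite_eq, Finset.mem_univ, if_true]
  rw [← coeff, ← coeff]
  exact congrArg (fun w => α (D k w)) (DFunLike.congr_fun (hK.commute p r x) (K l x ξ))

lemma mdifferentiableAt_structureFun (i j k : Fin n) (x : X) :
    MDifferentiableAt (𝓡 n) 𝓘(ℝ, ℝ) (fun y => structureFun K i j y k) x :=
  (hK.smoothFunOn_structureFun i j k).mdifferentiableAt isOpen_univ (mem_univ x)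

lemma frameDeriv_sum_structureFun_mul (x : X) (p r l : Fin n) (v : TangentSpace (𝓡 n) x) :
    frameDeriv K (fun k y => ∑ s, structureFun K r l y s * structureFun K p s y k) x v =
      K p x * frameDeriv K (fun k y => structureFun K r l y k) x v +
        ∑ s, structureFun K r l x s • frameDeriv K (fun k y => structureFun K p s y k) x v := by
  have hd := hK.mdifferentiableAt_structureFun
  have hmul (s : Fin n) : K p x * K s x = ∑ k, structureFun K p s x k • K k x :=
    hK.comp_eq_sum_structureFun x p s
  simp only [frameDeriv_apply, differential_sum_mul (hd r l · x) (hd p · _ x), Finset.sum_smul,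
    Finset.mul_sum, mul_smul_comm, hmul, Finset.smul_sum, add_smul, Finset.sum_add_distrib,
    mul_smul]
  rw [add_comm]
  simp only [smul_comm (structureFun _ _ _ _ _) (differential _ _ _ _)]
  exact congrArg₂ (· + ·) Finset.sum_comm Finset.sum_comm

lemma mul_frameDeriv_structureFun_comm (x : X) (p r l : Fin n) (v : TangentSpace (𝓡 n) x) :
    K p x * frameDeriv K (fun k y => structureFun K r l y k) x v +
        ∑ s, structureFun K r l x s • frameDeriv K (fun k y => structureFun K p s y k) x v =
      K r x * frameDeriv K (fun k y => structureFun K p l y k) x v +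
        ∑ s, structureFun K p l x s • frameDeriv K (fun k y => structureFun K r s y k) x v := by
  rw [← hK.frameDeriv_sum_structureFun_mul, ← hK.frameDeriv_sum_structureFun_mul]
  simp only [hK.structureFun_assoc _ p r l]

lemma linearityDefect_structureFun_comm (hsym : MutualSymmetriesOn univ K) (x : X)
    (p r l : Fin n) :
    linearityDefect (K p x) (frameDeriv K (fun k y => structureFun K r l y k) x) =
      linearityDefect (K r x) (frameDeriv K (fun k y => structureFun K p l y k) x) := by
  have comp_eq (r : Fin n) : (fun y => (K r y).comp (K l y)) =
      combination (fun k y => structureFun K r l y k) K :=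
    funext fun y => hK.comp_eq_sum_structureFun y r l
  have hcomm (p r : Fin n) (v : TangentSpace (𝓡 n) x) (i : Fin n) : Commute (K i x)
      (linearityDefect (K p x) (frameDeriv K (fun k y => structureFun K r l y k) x) v) :=
    commute_linearityDefect (hK.commute i p x) (commute_frameDeriv (hK.commute i · x) _) v
  obtain ⟨D, ζ, α, h⟩ := hK.exists_isDualPair x
  refine sub_eq_zero.1 (h.eq_zero_of_forall_self
    (fun v i => (hcomm p r v i).sub_right (hcomm r p v i)) fun v => sub_eq_zero.2 ?_)
  obtain ⟨V, hV, hxV, -, ξ, hξ, rfl⟩ := exists_smoothVFieldOn_eq isOpen_univ (mem_univ x) v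
  have defect_eq (p r : Fin n) :
      linearityDefect (K p x) (frameDeriv K (fun k y => structureFun K r l y k) x) (ξ x) (ξ x) =
        bracketTensor (K p) (K r) ξ (applyOp (K l) ξ) x := by
    rw [← IsSymmetryOn.bracketTensor_combination (hsym p) hV (subset_univ V)
      (fun k => (hK.smoothFunOn_structureFun r l k).mono (subset_univ V)) hξ hxV, ← comp_eq,
      bracketTensor_comp (hK.commute p r x),
      (hsym p l).bracketTensor_self hV (subset_univ V) hξ hxV, map_zero, add_zero]
  have hlξ : SmoothVFieldOn V (applyOp (K l) ξ) := ((hK.smooth l).mono (subset_univ V)).applyOp hξ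
  refine (defect_eq p r).trans (Eq.trans ?_ (defect_eq r p).symm)
  rw [bracketTensor_swap (hK.commute r p x), eq_neg_iff_add_eq_zero]
  exact (hsym p r).symm_part V hV (subset_univ V) ξ _ hξ hlξ x hxV

variable (ha : ∀ x, (frobeniusForm K a x).det ≠ 0)
include ha

lemma frameDeriv_frobeniusForm_inv (x : X) (j : Fin n) :
    frameDeriv K (fun k y => (frobeniusForm K a y)⁻¹ j k) x =
      ∑ r, (frobeniusForm K a x)⁻¹ j r • frobeniusFormDeriv K a x r := by
  ext1 v
  have hinv := differential_matrix_inv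
    (fun i j => (hK.smoothFunOn_frobeniusForm i j).mdifferentiableAt isOpen_univ (mem_univ x))
    (fun i j =>
      (hK.smoothFunOn_frobeniusForm_inv ha i j).mdifferentiableAt isOpen_univ (mem_univ x))
    ha v
  have hentry (k : Fin n) := congrFun₂ hinv j k
  simp only [Matrix.of_apply, Matrix.neg_apply, mul_assoc, Matrix.mul_apply] at hentry
  simp only [frameDeriv_apply, hentry, LinearMap.sum_apply, LinearMap.smul_apply,
    frobeniusFormDeriv_apply, dualBasis, smul_neg, neg_smul, Finset.sum_neg_distrib,
    Finset.sum_smul, Finset.smul_sum, Finset.mul_sum, mul_smul]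
  rw [Finset.sum_comm]
  exact congrArg _ (Finset.sum_congr rfl fun _ _ => Finset.sum_comm)

lemma linearityDefect_frobeniusFormDeriv_comm (hsym : MutualSymmetriesOn univ K) (x : X)
    (p r : Fin n) :
    linearityDefect (K p x) (frobeniusFormDeriv K a x r) =
      linearityDefect (K r x) (frobeniusFormDeriv K a x p) := by
  obtain ⟨ξ, α, hα, h⟩ := hK.exists_isDualPair_dualBasis (ha x)
  refine h.linearityDefect_comm_of_structure (fun r l => hK.comp_eq_sum_structureFun x r l)
    (hK.linearityDefect_structureFun_comm hsym x) (hK.mul_frameDeriv_structureFun_comm x)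
    (fun r v i => ?_) (fun r l v => ?_) p r
  · rw [frobeniusFormDeriv_apply]
    exact .neg_right (.sum_right _ _ _ fun q _ => (h.commute i q).smul_right _)
  · have hB : (fun y => frobeniusForm K a y r l) = fun y => ∑ k, a k * structureFun K r l y k := by
      simp only [frobeniusForm, Matrix.of_apply, mul_comm]
    have dB : differential n (fun y => frobeniusForm K a y r l) x v =
        ∑ k, a k * differential n (fun y => structureFun K r l y k) x v := by
      rw [hB, differential_linearCombination a (hK.mdifferentiableAt_structureFun r l · x)]
      simp
    rw [frobeniusFormDeriv_apply, frameDeriv_apply]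
    simp [h.symm.dual, dB, hα, mul_comm]

lemma commute_dualBasis (x : X) (i j : Fin n) :
    (dualBasis K a i x).comp (dualBasis K a j x) =
      (dualBasis K a j x).comp (dualBasis K a i x) := by
  obtain ⟨ξ, α, -, h⟩ := hK.exists_isDualPair_dualBasis (ha x)
  exact h.commute_right i j

theorem mutualSymmetriesOn_dualBasis (hsym : MutualSymmetriesOn univ K) :
    MutualSymmetriesOn univ (dualBasis K a) := fun i j => by
  refine (isSymmetryOn_iff_bracketTensor_self (hK.smoothOpFieldOn_dualBasis ha i)
    (hK.smoothOpFieldOn_dualBasis ha j) fun x _ => hK.commute_dualBasis ha x i j).2 ?_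
  intro V hV hVU ξ hξ x hx
  have hC (i j : Fin n) := (hK.smoothFunOn_frobeniusForm_inv ha i j).mono hVU
  change bracketTensor (combination (fun k y => (frobeniusForm K a y)⁻¹ i k) K)
    (combination (fun k y => (frobeniusForm K a y)⁻¹ j k) K) ξ ξ x = 0
  rw [hsym.bracketTensor_combination_combination hV hVU (hC i) (hC j) hξ hx, sub_eq_zero,
    hK.frameDeriv_frobeniusForm_inv ha, hK.frameDeriv_frobeniusForm_inv ha]
  exact congrArg (fun Φ => Φ (ξ x) (ξ x)) (linearityDefect_sum_smul_comm
    (hK.linearityDefect_frobeniusFormDeriv_comm ha hsym x) _ _)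

end IsOperatorFrobeniusAlgebra

end DualSymmetries

section Pullback

variable {n : ℕ} {X Y : Type*} [TopologicalSpace X] [ChartedSpace (EuclideanSpace ℝ (Fin n)) X]
  [TopologicalSpace Y] [ChartedSpace (EuclideanSpace ℝ (Fin n)) Y] {ψ : Y → X} {y : Y}

/-- The pullback `ψ^* α` of a `1`-form along a map between manifolds of the same dimension. The
vector fields are pulled back with `VectorField.mpullback`, which inverts the derivative of `ψ`. -/
noncomputable def formPullback (ψ : Y → X) (α : OneForm n X) : OneForm n Y :=
  fun y => (α (ψ y)).comp (mfderiv (𝓡 n) (𝓡 n) ψ y)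

lemma formPullback_apply_mpullback (hψ : (mfderiv (𝓡 n) (𝓡 n) ψ y).IsInvertible) (α : OneForm n X)
    (ξ : VField n X) :
    formPullback ψ α y (VectorField.mpullback (𝓡 n) (𝓡 n) ψ ξ y) = α (ψ y) (ξ (ψ y)) :=
  congrArg (α (ψ y)) (hψ.self_apply_inverse (ξ (ψ y)))

lemma formPullback_differential {f : X → ℝ} (hf : MDifferentiableAt (𝓡 n) 𝓘(ℝ, ℝ) f (ψ y))
    (hψ : MDifferentiableAt (𝓡 n) (𝓡 n) ψ y) :
    formPullback ψ (differential n f) y = differential n (fun z => f (ψ z)) y :=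
  (mvfderiv_comp y hf hψ).symm

variable [IsManifold (𝓡 n) ∞ X] [IsManifold (𝓡 n) ∞ Y] {W : Set Y} {V : Set X} {ξ η : VField n X}

lemma SmoothVFieldOn.mpullback (hW : IsOpen W) (hψ : ContMDiffOn (𝓡 n) (𝓡 n) ∞ ψ W)
    (hψ' : ∀ y ∈ W, (mfderiv (𝓡 n) (𝓡 n) ψ y).IsInvertible) (hV : IsOpen V)
    (hξ : SmoothVFieldOn V ξ) :
    SmoothVFieldOn (W ∩ ψ ⁻¹' V) (VectorField.mpullback (𝓡 n) (𝓡 n) ψ ξ) := fun y hy =>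
  (ContMDiffAt.mpullback_vectorField_preimage (ContMDiffOn.contMDiffAt hξ (hV.mem_nhds hy.2))
    (hψ.contMDiffAt (hW.mem_nhds hy.1)) (hψ' y hy.1) (by simp)).contMDiffWithinAt

lemma minSmoothness_two_le : minSmoothness ℝ 2 ≤ ∞ := by
  rw [minSmoothness_of_isRCLikeNormedField]
  exact WithTop.coe_le_coe.2 le_top

lemma extDerivForm_formPullback (hW : IsOpen W) (hψ : ContMDiffOn (𝓡 n) (𝓡 n) ∞ ψ W)
    (hψ' : ∀ y ∈ W, (mfderiv (𝓡 n) (𝓡 n) ψ y).IsInvertible) (hy : y ∈ W) (hV : IsOpen V)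
    (hyV : ψ y ∈ V) {α : OneForm n X} (hξ : SmoothVFieldOn V ξ) (hη : SmoothVFieldOn V η)
    (hαξ : SmoothFunOn n V fun x => α x (ξ x)) (hαη : SmoothFunOn n V fun x => α x (η x)) :
    extDerivForm (formPullback ψ α) (VectorField.mpullback (𝓡 n) (𝓡 n) ψ ξ)
      (VectorField.mpullback (𝓡 n) (𝓡 n) ψ η) y = extDerivForm α ξ η (ψ y) := by
  have : IsManifold (𝓡 n) (minSmoothness ℝ 2) X := .of_le minSmoothness_two_le
  have : IsManifold (𝓡 n) (minSmoothness ℝ 2) Y := .of_le minSmoothness_two_le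
  have hψy := hψ.contMDiffAt (hW.mem_nhds hy)
  have deriv_apply {ζ ρ : VField n X} (hαζ : SmoothFunOn n V fun x => α x (ζ x)) :
      differential n (fun z => formPullback ψ α z (VectorField.mpullback (𝓡 n) (𝓡 n) ψ ζ z)) y
        (VectorField.mpullback (𝓡 n) (𝓡 n) ψ ρ y) =
      differential n (fun x => α x (ζ x)) (ψ y) (ρ (ψ y)) := by
    rw [← formPullback_apply_mpullback (hψ' y hy), formPullback_differential
      (hαζ.mdifferentiableAt hV hyV) (hψy.mdifferentiableAt (by simp))]
    refine DFunLike.congr_fun (differential_congr ?_) _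
    filter_upwards [hW.mem_nhds hy] with z hz using formPullback_apply_mpullback (hψ' z hz) α ζ
  have bracket_eq : bracket (VectorField.mpullback (𝓡 n) (𝓡 n) ψ ξ)
      (VectorField.mpullback (𝓡 n) (𝓡 n) ψ η) y =
        VectorField.mpullback (𝓡 n) (𝓡 n) ψ (bracket ξ η) y :=
    (VectorField.mpullback_mlieBracket (hξ.mdifferentiableAt hV hyV)
      (hη.mdifferentiableAt hV hyV) hψy minSmoothness_two_le).symm
  rw [extDerivForm, extDerivForm, deriv_apply hαη, deriv_apply hαξ, bracket_eq,
    formPullback_apply_mpullback (hψ' y hy)]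

end Pullback

section ExteriorDerivative

variable {n : ℕ}

lemma bracket_modelSpace (ξ η : VField n (EuclideanSpace ℝ (Fin n))) :
    bracket ξ η = VectorField.lieBracket ℝ ξ η := by
  rw [bracket, ← VectorField.mlieBracketWithin_univ,
    VectorField.mlieBracketWithin_eq_lieBracketWithin]
  exact VectorField.lieBracketWithin_univ

lemma differential_modelSpace (f : EuclideanSpace ℝ (Fin n) → ℝ) (z : EuclideanSpace ℝ (Fin n)) :
    differential n f z = fderiv ℝ f z := by
  ext v
  exact congrArg (fun L : EuclideanSpace ℝ (Fin n) →L[ℝ] ℝ => L v) mfderiv_eq_fderiv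

lemma extDerivForm_modelSpace {θ : EuclideanSpace ℝ (Fin n) → EuclideanSpace ℝ (Fin n) →L[ℝ] ℝ}
    {ξ η : EuclideanSpace ℝ (Fin n) → EuclideanSpace ℝ (Fin n)} {z : EuclideanSpace ℝ (Fin n)}
    (hθ : DifferentiableAt ℝ θ z) (hξ : DifferentiableAt ℝ ξ z) (hη : DifferentiableAt ℝ η z) :
    extDerivForm (n := n) θ ξ η z = fderiv ℝ θ z (ξ z) (η z) - fderiv ℝ θ z (η z) (ξ z) := by
  have deriv_apply {ζ : EuclideanSpace ℝ (Fin n) → EuclideanSpace ℝ (Fin n)}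
      (hζ : DifferentiableAt ℝ ζ z) (v : EuclideanSpace ℝ (Fin n)) :
      differential n (fun y => θ y (ζ y)) z v = θ z (fderiv ℝ ζ z v) + fderiv ℝ θ z v (ζ z) := by
    rw [differential_modelSpace]
    exact congrArg (fun L : EuclideanSpace ℝ (Fin n) →L[ℝ] ℝ => L v) (fderiv_clm_apply hθ hζ)
  have bracket_apply :
      θ z (bracket (n := n) ξ η z) = θ z (fderiv ℝ η z (ξ z)) - θ z (fderiv ℝ ξ z (η z)) :=
    (congrArg (θ z) (congrFun (bracket_modelSpace ξ η) z)).trans (map_sub (θ z) _ _)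
  unfold extDerivForm
  linear_combination deriv_apply hη (ξ z) - deriv_apply hξ (η z) - bracket_apply

end ExteriorDerivative

section Charts

variable {n : ℕ} {X : Type*} [TopologicalSpace X] [ChartedSpace (EuclideanSpace ℝ (Fin n)) X]
  {x : X} {z v : EuclideanSpace ℝ (Fin n)} {U V : Set X}

lemma isOpen_extChartAt_target_inter_preimage (x : X) (hU : IsOpen U) :
    IsOpen ((extChartAt (𝓡 n) x).target ∩ (extChartAt (𝓡 n) x).symm ⁻¹' U) :=
  (continuousOn_extChartAt_symm x).isOpen_inter_preimage (isOpen_extChartAt_target x) hU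

variable [IsManifold (𝓡 n) ∞ X]

lemma isInvertible_mfderiv_extChartAt_symm (hz : z ∈ (extChartAt (𝓡 n) x).target) :
    (mfderiv (𝓡 n) (𝓡 n) (extChartAt (𝓡 n) x).symm z).IsInvertible := by
  simpa only [ModelWithCorners.range_eq_univ, mfderivWithin_univ] using
    isInvertible_mfderivWithin_extChartAt_symm hz

lemma mfderiv_extChartAt_comp_mfderiv_extChartAt_symm (hz : z ∈ (extChartAt (𝓡 n) x).target) :
    (mfderiv (𝓡 n) (𝓡 n) (extChartAt (𝓡 n) x) ((extChartAt (𝓡 n) x).symm z)).comp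
      (mfderiv (𝓡 n) (𝓡 n) (extChartAt (𝓡 n) x).symm z) = ContinuousLinearMap.id ℝ _ := by
  simpa only [ModelWithCorners.range_eq_univ, mfderivWithin_univ] using
    mfderiv_extChartAt_comp_mfderivWithin_extChartAt_symm hz

/-- The vector field with constant components `v` in the chart at `x`. -/
noncomputable def coordField (x : X) (v : EuclideanSpace ℝ (Fin n)) : VField n X :=
  VectorField.mpullback (𝓡 n) (𝓡 n) (extChartAt (𝓡 n) x) (fun _ => v)

lemma coordField_extChartAt_symm (hz : z ∈ (extChartAt (𝓡 n) x).target) :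
    coordField x v ((extChartAt (𝓡 n) x).symm z) =
      mfderiv (𝓡 n) (𝓡 n) (extChartAt (𝓡 n) x).symm z v :=
  (isInvertible_mfderiv_extChartAt ((extChartAt (𝓡 n) x).map_target hz)).inverse_apply_eq.2
    (DFunLike.congr_fun (mfderiv_extChartAt_comp_mfderiv_extChartAt_symm hz) v).symm

/-- The local representative of a vector field in the chart at `x`. -/
noncomputable def chartField (x : X) (ξ : VField n X) :
    EuclideanSpace ℝ (Fin n) → EuclideanSpace ℝ (Fin n) :=
  VectorField.mpullback (𝓡 n) (𝓡 n) (extChartAt (𝓡 n) x).symm ξ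

/-- The local representative of a `1`-form in the chart at `x`. -/
noncomputable def chartForm (x : X) (α : OneForm n X) :
    EuclideanSpace ℝ (Fin n) → EuclideanSpace ℝ (Fin n) →L[ℝ] ℝ :=
  formPullback (extChartAt (𝓡 n) x).symm α

lemma chartField_coordField (hz : z ∈ (extChartAt (𝓡 n) x).target) :
    chartField x (coordField x v) z = v :=
  (isInvertible_mfderiv_extChartAt_symm hz).inverse_apply_eq.2 (coordField_extChartAt_symm hz)

lemma chartForm_apply (hz : z ∈ (extChartAt (𝓡 n) x).target) (α : OneForm n X) :
    chartForm x α z v =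
      α ((extChartAt (𝓡 n) x).symm z) (coordField x v ((extChartAt (𝓡 n) x).symm z)) :=
  (congrArg (α _) (coordField_extChartAt_symm hz)).symm

lemma contMDiffAt_extChartAt_symm (hz : z ∈ (extChartAt (𝓡 n) x).target) :
    ContMDiffAt (𝓡 n) (𝓡 n) ∞ (extChartAt (𝓡 n) x).symm z :=
  (contMDiffOn_extChartAt_symm x).contMDiffAt ((isOpen_extChartAt_target x).mem_nhds hz)

lemma chartForm_differential {f : X → ℝ} (hU : IsOpen U) (hf : SmoothFunOn n U f)
    (hz : z ∈ (extChartAt (𝓡 n) x).target) (hzU : (extChartAt (𝓡 n) x).symm z ∈ U) :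
    chartForm x (differential n f) z = fderiv ℝ (fun y => f ((extChartAt (𝓡 n) x).symm y)) z :=
  (formPullback_differential (hf.mdifferentiableAt hU hzU)
    ((contMDiffAt_extChartAt_symm hz).mdifferentiableAt (by simp))).trans
    (differential_modelSpace _ z)

lemma contMDiffOn_extChartAt_source (x : X) :
    ContMDiffOn (𝓡 n) (𝓡 n) ∞ (extChartAt (𝓡 n) x) (extChartAt (𝓡 n) x).source := by
  rw [extChartAt_source]
  exact contMDiffOn_extChartAt

lemma smoothVFieldOn_coordField (x : X) (v : EuclideanSpace ℝ (Fin n)) :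
    SmoothVFieldOn (extChartAt (𝓡 n) x).source (coordField x v) := by
  have hv : SmoothVFieldOn univ fun _ : EuclideanSpace ℝ (Fin n) => v :=
    contMDiffOn_univ.2 (contMDiff_vectorSpace_iff_contDiff.2 contDiff_const)
  exact (hv.mpullback (isOpen_extChartAt_source x) (contMDiffOn_extChartAt_source x)
    (fun _ => isInvertible_mfderiv_extChartAt) isOpen_univ).mono fun _ hy => ⟨hy, mem_univ _⟩

lemma SmoothVFieldOn.differentiableAt_chartField {ξ : VField n X} (hV : IsOpen V)
    (hξ : SmoothVFieldOn V ξ) (hz : z ∈ (extChartAt (𝓡 n) x).target)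
    (hzV : (extChartAt (𝓡 n) x).symm z ∈ V) :
    DifferentiableAt ℝ (chartField x ξ) z := by
  have h := hξ.mpullback (isOpen_extChartAt_target x) (contMDiffOn_extChartAt_symm x)
    (fun _ => isInvertible_mfderiv_extChartAt_symm) hV
  exact (contMDiffAt_vectorSpace_iff_contDiffAt.1 (ContMDiffOn.contMDiffAt h
    ((isOpen_extChartAt_target_inter_preimage x hV).mem_nhds ⟨hz, hzV⟩))).differentiableAt (by simp)

lemma SmoothFunOn.contDiffAt_comp_extChartAt_symm {f : X → ℝ} (hU : IsOpen U)
    (hf : SmoothFunOn n U f) (hz : z ∈ (extChartAt (𝓡 n) x).target)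
    (hzU : (extChartAt (𝓡 n) x).symm z ∈ U) :
    ContDiffAt ℝ ∞ (fun y => f ((extChartAt (𝓡 n) x).symm y)) z :=
  contMDiffAt_iff_contDiffAt.1 <| (ContMDiffOn.contMDiffAt hf (hU.mem_nhds hzU)).comp z <|
    contMDiffAt_extChartAt_symm hz

lemma extDerivForm_extChartAt_symm {α : OneForm n X} {ξ η : VField n X}
    (hz : z ∈ (extChartAt (𝓡 n) x).target) (hV : IsOpen V)
    (hzV : (extChartAt (𝓡 n) x).symm z ∈ V) (hξ : SmoothVFieldOn V ξ) (hη : SmoothVFieldOn V η)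
    (hαξ : SmoothFunOn n V fun y => α y (ξ y)) (hαη : SmoothFunOn n V fun y => α y (η y))
    (hα : DifferentiableAt ℝ (chartForm x α) z) :
    extDerivForm α ξ η ((extChartAt (𝓡 n) x).symm z) =
      fderiv ℝ (chartForm x α) z (chartField x ξ z) (chartField x η z) -
        fderiv ℝ (chartForm x α) z (chartField x η z) (chartField x ξ z) :=
  (extDerivForm_formPullback (isOpen_extChartAt_target x) (contMDiffOn_extChartAt_symm x)
    (fun _ => isInvertible_mfderiv_extChartAt_symm) hz hV hzV hξ hη hαξ hαη).symm.trans
    (extDerivForm_modelSpace hα (hξ.differentiableAt_chartField hV hz hzV)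
      (hη.differentiableAt_chartField hV hz hzV))

end Charts

section ClosedForms

variable {n : ℕ} {X : Type*} [TopologicalSpace X] [ChartedSpace (EuclideanSpace ℝ (Fin n)) X]
  [IsManifold (𝓡 n) ∞ X] {x : X} {z : EuclideanSpace ℝ (Fin n)} {U : Set X}
  {α α' : OneForm n X}

/-- A `1`-form is smooth on `U` if it takes smooth values on the vector fields that are defined and
smooth on some open subset of `U`, as in the definition of `IsClosedFormOn`. -/
def SmoothFormOn (U : Set X) (α : OneForm n X) : Prop :=
  ∀ V : Set X, IsOpen V → V ⊆ U → ∀ ξ : VField n X, SmoothVFieldOn V ξ →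
    SmoothFunOn n V fun x => α x (ξ x)

lemma SmoothFormOn.pullForm {L : OpField n X} (hα : SmoothFormOn U α) (hL : SmoothOpFieldOn U L) :
    SmoothFormOn U (pullForm L α) := fun V hV hVU ξ hξ =>
  hα V hV hVU (applyOp L ξ) (SmoothOpFieldOn.applyOp (hL.mono hVU) hξ)

lemma SmoothFunOn.smoothFormOn_differential {f : X → ℝ} (hf : SmoothFunOn n U f) :
    SmoothFormOn U (differential n f) := fun V hV hVU ξ hξ => by
  have htangent := ContMDiffOn.contMDiffOn_tangentMapWithin (m := ∞) (hf.mono hVU) (by simp)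
    hV.uniqueMDiffOn
  refine ((contMDiff_snd_tangentBundle_modelSpace ℝ 𝓘(ℝ, ℝ) (n := ∞)).comp_contMDiffOn
    (htangent.comp hξ fun _ hy => hy)).congr fun y hy => ?_
  exact congrArg (fun L : EuclideanSpace ℝ (Fin n) →L[ℝ] ℝ => L (ξ y))
    (mfderivWithin_of_isOpen hV hy).symm

lemma SmoothFormOn.contDiffOn_chartForm (hU : IsOpen U) (hα : SmoothFormOn U α) (x : X) :
    ContDiffOn ℝ ∞ (chartForm x α)
      ((extChartAt (𝓡 n) x).target ∩ (extChartAt (𝓡 n) x).symm ⁻¹' U) := by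
  have hV := (isOpen_extChartAt_source (I := 𝓡 n) x).inter hU
  refine contDiffOn_clm_apply.2 fun v => ?_
  have hαv := hα _ hV inter_subset_right _ ((smoothVFieldOn_coordField x v).mono inter_subset_left)
  refine ContDiffOn.congr (fun z hz => ?_) fun z hz => chartForm_apply hz.1 α
  exact (hαv.contDiffAt_comp_extChartAt_symm hV hz.1
    ⟨(extChartAt (𝓡 n) x).map_target hz.1, hz.2⟩).contDiffWithinAt

lemma SmoothFormOn.differentiableAt_chartForm (hU : IsOpen U) (hα : SmoothFormOn U α)
    (hz : z ∈ (extChartAt (𝓡 n) x).target) (hzU : (extChartAt (𝓡 n) x).symm z ∈ U) :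
    DifferentiableAt ℝ (chartForm x α) z :=
  ((hα.contDiffOn_chartForm hU x).contDiffAt
    ((isOpen_extChartAt_target_inter_preimage x hU).mem_nhds ⟨hz, hzU⟩)).differentiableAt (by simp)

lemma SmoothFunOn.isClosedFormOn_differential {f : X → ℝ} (hf : SmoothFunOn n U f) :
    IsClosedFormOn U (differential n f) := by
  intro V hV hVU ξ η hξ hη x hx
  set φ := extChartAt (𝓡 n) x
  have hz : φ x ∈ φ.target := mem_extChartAt_target x
  have hφx : φ.symm (φ x) = x := extChartAt_to_inv x
  have hzV : φ.symm (φ x) ∈ V := by rwa [hφx]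
  have hdf := (hf.mono hVU).smoothFormOn_differential
  have hform : chartForm x (differential n f) =ᶠ[𝓝 (φ x)] fderiv ℝ fun y => f (φ.symm y) := by
    filter_upwards [(isOpen_extChartAt_target_inter_preimage x hV).mem_nhds ⟨hz, hzV⟩] with w hw
    exact chartForm_differential hV (hf.mono hVU) hw.1 hw.2
  have hsymm := (((hf.mono hVU).contDiffAt_comp_extChartAt_symm hV hz hzV).isSymmSndFDerivAt
    minSmoothness_two_le).eq (chartField x ξ (φ x)) (chartField x η (φ x))
  have hext := extDerivForm_extChartAt_symm hz hV hzV hξ hη (hdf V hV subset_rfl ξ hξ)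
    (hdf V hV subset_rfl η hη) (hdf.differentiableAt_chartForm hV hz hzV)
  rwa [hform.fderiv_eq, hsymm, sub_self, hφx] at hext

lemma IsClosedFormOn.congr (h : IsClosedFormOn U α) (hαα' : ∀ x ∈ U, α x = α' x) :
    IsClosedFormOn U α' := by
  intro V hV hVU ξ η hξ hη x hx
  have deriv_eq (ζ : VField n X) :
      differential n (fun y => α' y (ζ y)) x = differential n (fun y => α y (ζ y)) x := by
    refine differential_congr ?_
    filter_upwards [hV.mem_nhds hx] with y hy
    rw [hαα' y (hVU hy)]
  have hα := h V hV hVU ξ η hξ hη x hx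
  rw [extDerivForm] at hα ⊢
  rw [deriv_eq, deriv_eq, ← hαα' x (hVU hx), hα]

lemma isClosedFormOn_of_local
    (h : ∀ x ∈ U, ∃ V : Set X, IsOpen V ∧ x ∈ V ∧ IsClosedFormOn V α) : IsClosedFormOn U α := by
  intro V hV hVU ξ η hξ hη x hx
  obtain ⟨W, hW, hxW, hα⟩ := h x (hVU hx)
  exact hα (V ∩ W) (hV.inter hW) inter_subset_right ξ η (hξ.mono inter_subset_left)
    (hη.mono inter_subset_left) x ⟨hx, hxW⟩

lemma IsClosedFormOn.fderiv_chartForm_symm (hU : IsOpen U) (hα : IsClosedFormOn U α)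
    (hs : SmoothFormOn U α) (hz : z ∈ (extChartAt (𝓡 n) x).target)
    (hzU : (extChartAt (𝓡 n) x).symm z ∈ U) (u v : EuclideanSpace ℝ (Fin n)) :
    fderiv ℝ (chartForm x α) z u v = fderiv ℝ (chartForm x α) z v u := by
  set V := (extChartAt (𝓡 n) x).source ∩ U
  have hV : IsOpen V := (isOpen_extChartAt_source (I := 𝓡 n) x).inter hU
  have hzV : (extChartAt (𝓡 n) x).symm z ∈ V := ⟨(extChartAt (𝓡 n) x).map_target hz, hzU⟩
  have hsmooth (w : EuclideanSpace ℝ (Fin n)) : SmoothVFieldOn V (coordField x w) :=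
    (smoothVFieldOn_coordField x w).mono inter_subset_left
  have hext := extDerivForm_extChartAt_symm hz hV hzV (hsmooth u) (hsmooth v)
    (hs V hV inter_subset_right _ (hsmooth u)) (hs V hV inter_subset_right _ (hsmooth v))
    (hs.differentiableAt_chartForm hU hz hzU)
  rw [hα V hV inter_subset_right _ _ (hsmooth u) (hsmooth v) _ hzV, chartField_coordField hz,
    chartField_coordField hz] at hext
  exact sub_eq_zero.1 hext.symm

lemma IsClosedFormOn.exists_primitive_chartForm (hU : IsOpen U) (hα : IsClosedFormOn U α)
    (hs : SmoothFormOn U α) {z₀ : EuclideanSpace ℝ (Fin n)} {r : ℝ}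
    (hr : Metric.ball z₀ r ⊆ (extChartAt (𝓡 n) x).target ∩ (extChartAt (𝓡 n) x).symm ⁻¹' U) :
    ∃ g : EuclideanSpace ℝ (Fin n) → ℝ, ContDiffOn ℝ ∞ g (Metric.ball z₀ r) ∧
      ∀ z ∈ Metric.ball z₀ r, HasFDerivAt g (chartForm x α z) z := by
  have hsmooth := (hs.contDiffOn_chartForm hU x).mono hr
  obtain ⟨g, hg⟩ := (convex_ball z₀ r).exists_forall_hasFDerivAt_of_fderiv_symmetric
    Metric.isOpen_ball (hsmooth.differentiableOn (by simp))
    fun z hz => hα.fderiv_chartForm_symm hU hs (hr hz).1 (hr hz).2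
  refine ⟨g, ?_, hg⟩
  rw [contDiffOn_infty_iff_fderiv_of_isOpen Metric.isOpen_ball]
  exact ⟨fun z hz => (hg z hz).differentiableAt.differentiableWithinAt,
    hsmooth.congr fun z hz => (hg z hz).fderiv⟩

lemma formPullback_chartForm {y : X} (hy : y ∈ (extChartAt (𝓡 n) x).source) :
    formPullback (extChartAt (𝓡 n) x) (chartForm x α) y = α y := by
  obtain ⟨z, hz, rfl⟩ := (extChartAt (𝓡 n) x).symm.surjOn hy
  ext w
  change chartForm x α (extChartAt (𝓡 n) x ((extChartAt (𝓡 n) x).symm z)) _ = _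
  rw [(extChartAt (𝓡 n) x).right_inv hz]
  exact (chartForm_apply hz α).trans
    (congrArg (α _) ((isInvertible_mfderiv_extChartAt hy).inverse_apply_self w))

lemma eq_differential_of_hasFDerivAt_chartForm {g : EuclideanSpace ℝ (Fin n) → ℝ} {y : X}
    (hy : y ∈ (extChartAt (𝓡 n) x).source)
    (hg : HasFDerivAt g (chartForm x α (extChartAt (𝓡 n) x y)) (extChartAt (𝓡 n) x y)) :
    α y = differential n (fun w => g (extChartAt (𝓡 n) x w)) y := by
  have hφ := (contMDiffOn_extChartAt_source x).contMDiffAt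
    ((isOpen_extChartAt_source x).mem_nhds hy)
  have hgα := hg.fderiv.symm.trans (differential_modelSpace g _).symm
  rw [← formPullback_chartForm (α := α) hy]
  exact (congrArg (fun β => ContinuousLinearMap.comp β _) hgα).trans <|
    formPullback_differential hg.differentiableAt.mdifferentiableAt
      (hφ.mdifferentiableAt (by simp))

lemma IsClosedFormOn.exists_differential_eq (hU : IsOpen U) (hα : IsClosedFormOn U α)
    (hs : SmoothFormOn U α) (hx : x ∈ U) :
    ∃ V : Set X, IsOpen V ∧ x ∈ V ∧ V ⊆ U ∧ ∃ f : X → ℝ, SmoothFunOn n V f ∧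
      ∀ y ∈ V, α y = differential n f y := by
  set φ := extChartAt (𝓡 n) x
  have hφx : φ x ∈ φ.target ∩ φ.symm ⁻¹' U :=
    ⟨mem_extChartAt_target x, by rwa [mem_preimage, extChartAt_to_inv x]⟩
  obtain ⟨r, hr, hball⟩ :=
    Metric.isOpen_iff.1 (isOpen_extChartAt_target_inter_preimage x hU) (φ x) hφx
  obtain ⟨g, hgs, hg⟩ := hα.exists_primitive_chartForm hU hs hball
  refine ⟨φ.source ∩ φ ⁻¹' Metric.ball (φ x) r, isOpen_extChartAt_preimage' x Metric.isOpen_ball,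
    ⟨mem_extChartAt_source x, Metric.mem_ball_self hr⟩, fun y hy => ?_, fun y => g (φ y),
    fun y hy => ?_, fun y hy => eq_differential_of_hasFDerivAt_chartForm hy.1 (hg _ hy.2)⟩
  · have hyU : φ.symm (φ y) ∈ U := (hball hy.2).2
    rwa [φ.left_inv hy.1] at hyU
  · exact ((hgs.contDiffAt (Metric.isOpen_ball.mem_nhds hy.2)).contMDiffAt.comp y
      ((contMDiffOn_extChartAt_source x).contMDiffAt
        ((isOpen_extChartAt_source x).mem_nhds hy.1))).contMDiffWithinAt

end ClosedForms

section Correspondence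

variable {n : ℕ} {X : Type*} [TopologicalSpace X] [ChartedSpace (EuclideanSpace ℝ (Fin n)) X]
  [IsManifold (𝓡 n) ∞ X] {K : Fin n → OpField n X} {a : Fin n → ℝ} {U : Set X} {f : X → ℝ}
  {h : Fin n → X → ℝ}

lemma isCommonConservationLawOn_of_pullForm_eq (hf : SmoothFunOn n U f)
    (hh : ∀ i, SmoothFunOn n U (h i))
    (hfh : ∀ i, ∀ x ∈ U, pullForm (K i) (differential n f) x = differential n (h i) x) :
    IsCommonConservationLawOn U K (differential n f) := fun i =>
  ⟨hf.isClosedFormOn_differential,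
    (hh i).isClosedFormOn_differential.congr fun x hx => (hfh i x hx).symm⟩

lemma isCommonConservationLawOn_of_local {α : OneForm n X}
    (hα : ∀ x ∈ U, ∃ V : Set X, IsOpen V ∧ x ∈ V ∧ IsCommonConservationLawOn V K α) :
    IsCommonConservationLawOn U K α := fun i =>
  ⟨isClosedFormOn_of_local fun x hx =>
      (hα x hx).imp fun _ hV => ⟨hV.1, hV.2.1, (hV.2.2 i).1⟩,
    isClosedFormOn_of_local fun x hx =>
      (hα x hx).imp fun _ hV => ⟨hV.1, hV.2.1, (hV.2.2 i).2⟩⟩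

lemma IsCommonConservationLawOn.exists_potentials (hK : ∀ i, SmoothOpFieldOn U (K i))
    (hU : IsOpen U) (hf : SmoothFunOn n U f)
    (hKf : IsCommonConservationLawOn U K (differential n f)) {x : X} (hx : x ∈ U) :
    ∃ V : Set X, IsOpen V ∧ x ∈ V ∧ V ⊆ U ∧ ∃ h : Fin n → X → ℝ, (∀ i, SmoothFunOn n V (h i)) ∧
      ∀ i, ∀ y ∈ V, pullForm (K i) (differential n f) y = differential n (h i) y := by
  choose V hV hxV _ h hh hfh using fun i =>
    (hKf i).2.exists_differential_eq hU (hf.smoothFormOn_differential.pullForm (hK i)) hx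
  exact ⟨U ∩ ⋂ i, V i, hU.inter (isOpen_iInter_of_finite hV), ⟨hx, mem_iInter.2 hxV⟩,
    inter_subset_left, h, fun i => (hh i).mono (inter_subset_right.trans (iInter_subset V i)),
    fun i y hy => hfh i y (mem_iInter.1 hy.2 i)⟩

variable (hK : IsOperatorFrobeniusAlgebra K) (ha : ∀ x, (frobeniusForm K a x).det ≠ 0)
include hK ha

lemma sum_smul_dualBasis (x : X) :
    ∑ i, a i • dualBasis K a i x = ContinuousLinearMap.id ℝ (TangentSpace (𝓡 n) x) := by
  obtain ⟨ξ, α, hα, h⟩ := hK.exists_isDualPair_dualBasis (ha x)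
  simp only [← hα]
  exact h.symm.sum_smul_eq (P := 1) fun _ => .one_right _

lemma differential_linearCombination_eq_of_pullForm_dualBasis (hU : IsOpen U)
    (hh : ∀ i, SmoothFunOn n U (h i)) {x : X} (hx : x ∈ U)
    (hfh : ∀ i, pullForm (dualBasis K a i) (differential n f) x = differential n (h i) x) :
    differential n (fun y => ∑ s, a s * h s y) x = differential n f x := by
  rw [differential_linearCombination a fun i => (hh i).mdifferentiableAt hU hx]
  ext v
  have hv : ∑ s, a s • dualBasis K a s x v = v := by
    simpa using DFunLike.congr_fun (sum_smul_dualBasis hK ha x) v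
  calc (∑ s, a s • differential n (h s) x) v
      = differential n f x (∑ s, a s • dualBasis K a s x v) := by simp [← hfh, pullForm]
    _ = differential n f x v := by rw [hv]

variable (hsym : MutualSymmetriesOn univ K) (hU : IsOpen U)
include hsym hU

lemma isCommonSymmetryOn_combination_iff_isCommonConservationLawOn
    (hh : ∀ i, SmoothFunOn n U (h i)) :
    IsCommonSymmetryOn U K (combination h K) ↔
      IsCommonConservationLawOn U (dualBasis K a) (differential n fun x => ∑ s, a s * h s x) ∧
        ∀ i, ∀ x ∈ U, pullForm (dualBasis K a i) (differential n fun y => ∑ s, a s * h s y) x =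
          differential n (h i) x := by
  rw [isCommonSymmetryOn_combination_iff_pullForm hK ha hsym hU hh]
  exact ⟨fun hpull => ⟨isCommonConservationLawOn_of_pullForm_eq
    (smoothFunOn_linearCombination a hh) hh hpull, hpull⟩, And.right⟩

lemma isCommonSymmetryOn_combination_of_pullForm (hh : ∀ i, SmoothFunOn n U (h i))
    (hfh : ∀ i, ∀ x ∈ U, pullForm (dualBasis K a i) (differential n f) x =
      differential n (h i) x) :
    IsCommonSymmetryOn U K (combination h K) := by
  refine (isCommonSymmetryOn_combination_iff_pullForm hK ha hsym hU hh).2 fun i x hx => ?_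
  rw [← hfh i x hx, pullForm, pullForm,
    differential_linearCombination_eq_of_pullForm_dualBasis hK ha hU hh hx fun i => hfh i x hx]

lemma isCommonConservationLawOn_dualBasis_iff (hf : SmoothFunOn n U f) :
    IsCommonConservationLawOn U (dualBasis K a) (differential n f) ↔
      ∀ x ∈ U, ∃ V : Set X, IsOpen V ∧ x ∈ V ∧ V ⊆ U ∧ ∃ h : Fin n → X → ℝ,
        (∀ i, SmoothFunOn n V (h i)) ∧
        (∀ i, ∀ y ∈ V, pullForm (dualBasis K a i) (differential n f) y =
          differential n (h i) y) ∧
        IsCommonSymmetryOn V K (combination h K) := by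
  refine ⟨fun hMf x hx => ?_, fun hloc => isCommonConservationLawOn_of_local fun x hx => ?_⟩
  · obtain ⟨V, hV, hxV, hVU, h, hh, hfh⟩ := hMf.exists_potentials
      (fun i => (hK.smoothOpFieldOn_dualBasis ha i).mono (subset_univ U)) hU hf hx
    exact ⟨V, hV, hxV, hVU, h, hh, hfh,
      isCommonSymmetryOn_combination_of_pullForm hK ha hsym hV hh hfh⟩
  · obtain ⟨V, hV, hxV, hVU, h, hh, hfh, -⟩ := hloc x hx
    exact ⟨V, hV, hxV, isCommonConservationLawOn_of_pullForm_eq (hf.mono hVU) hh hfh⟩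

lemma isCommonConservationLawOn_dualBasis_iff_exists_differential_eq (hf : SmoothFunOn n U f) :
    IsCommonConservationLawOn U (dualBasis K a) (differential n f) ↔
      ∀ x ∈ U, ∃ V : Set X, IsOpen V ∧ x ∈ V ∧ V ⊆ U ∧ ∃ h : Fin n → X → ℝ,
        (∀ i, SmoothFunOn n V (h i)) ∧
        (∀ y ∈ V, differential n (fun z => ∑ s, a s * h s z) y = differential n f y) ∧
        (∀ i, ∀ y ∈ V, pullForm (dualBasis K a i) (differential n f) y =
          differential n (h i) y) ∧
        IsCommonSymmetryOn V K (combination h K) := by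
  rw [isCommonConservationLawOn_dualBasis_iff hK ha hsym hU hf]
  refine forall₂_congr fun x _ => ⟨?_, ?_⟩
  · rintro ⟨V, hV, hxV, hVU, h, hh, hfh, hcs⟩
    exact ⟨V, hV, hxV, hVU, h, hh, fun y hy =>
      differential_linearCombination_eq_of_pullForm_dualBasis hK ha hV hh hy (hfh · y hy), hfh, hcs⟩
  · rintro ⟨V, hV, hxV, hVU, h, hh, -, hfh, hcs⟩
    exact ⟨V, hV, hxV, hVU, h, hh, hfh, hcs⟩

end Correspondence

section Duality

variable {n : ℕ} {X : Type*} [TopologicalSpace X] [ChartedSpace (EuclideanSpace ℝ (Fin n)) X]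
  [IsManifold (𝓡 n) ∞ X] {K : Fin n → OpField n X} (hK : IsOperatorFrobeniusAlgebra K)
  {a : Fin n → ℝ} (ha : ∀ x, (frobeniusForm K a x).det ≠ 0)
include hK ha

lemma isOperatorFrobeniusAlgebra_dualBasis : IsOperatorFrobeniusAlgebra (dualBasis K a) where
  smooth := hK.smoothOpFieldOn_dualBasis ha
  commute i j x := hK.commute_dualBasis ha x i j
  exists_generic_vector x := by
    obtain ⟨ξ, α, -, h⟩ := hK.exists_isDualPair_dualBasis (ha x)
    exact ⟨ξ, h.symm.linearIndependent⟩
  exists_generic_covector x := by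
    obtain ⟨ξ, α, -, h⟩ := hK.exists_isDualPair_dualBasis (ha x)
    have : T2Space (TangentSpace (𝓡 n) x) := inferInstanceAs (T2Space (EuclideanSpace ℝ (Fin n)))
    exact ⟨α.toContinuousLinearMap, .of_comp (ContinuousLinearMap.coeLM ℝ)
      h.symm.linearIndependent_comp⟩

variable {β : Fin n → ℝ}
  (hβ : ∀ x : X, ContinuousLinearMap.id ℝ (TangentSpace (𝓡 n) x) = ∑ i, β i • K i x)
include hβ

lemma frobeniusForm_dualBasis (x : X) :
    frobeniusForm (dualBasis K a) β x = (frobeniusForm K a x)⁻¹ := by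
  obtain ⟨ξ, α, hα, h⟩ := hK.exists_isDualPair_dualBasis (ha x)
  have hβξ : ∑ i, β i • K i x ξ = ξ := by
    simpa using (DFunLike.congr_fun (hβ x) ξ).symm
  have hα' (k : Fin n) : α (dualBasis K a k x ξ) = β k := by
    simpa only [hβξ] using h.apply_sum_smul β k
  calc frobeniusForm (dualBasis K a) β x
      = .of fun i j => α (dualBasis K a i x (dualBasis K a j x ξ)) :=
        Matrix.ext ((isOperatorFrobeniusAlgebra_dualBasis hK ha).frobeniusForm_apply hα')
    _ = (Matrix.of fun i j => α (K i x (K j x ξ)))⁻¹ := h.right_mul_right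
    _ = (frobeniusForm K a x)⁻¹ :=
        congrArg _ (Matrix.ext (hK.frobeniusForm_apply hα)).symm

lemma det_frobeniusForm_dualBasis_ne_zero (x : X) :
    (frobeniusForm (dualBasis K a) β x).det ≠ 0 := by
  rw [frobeniusForm_dualBasis hK ha hβ, Matrix.det_nonsing_inv, Ring.inverse_eq_inv']
  exact inv_ne_zero (ha x)

lemma dualBasis_dualBasis : dualBasis (dualBasis K a) β = K := by
  funext i x
  obtain ⟨ξ, α, hα, h⟩ := hK.exists_isDualPair_dualBasis (ha x)
  have hcomm (j : Fin n) : K i x (K j x ξ) = K j x (K i x ξ) :=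
    DFunLike.congr_fun (h.commute_left i j).eq ξ
  calc dualBasis (dualBasis K a) β i x
      = ∑ j, frobeniusForm K a x i j • dualBasis K a j x := by
        rw [dualBasis, frobeniusForm_dualBasis hK ha hβ,
          Matrix.nonsing_inv_nonsing_inv _ (ha x).isUnit]
    _ = ∑ j, α (K j x (K i x ξ)) • dualBasis K a j x := by
        simp only [hK.frobeniusForm_apply hα, hcomm]
    _ = K i x := h.symm.sum_smul_eq fun j => (h.commute i j).symm

end Duality

end OperatorFrobenius

theorem theorem2 {n : ℕ} {X : Type*} [TopologicalSpace X]
    [ChartedSpace (EuclideanSpace ℝ (Fin n)) X] [IsManifold (𝓡 n) ∞ X]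
    (K : Fin n → OpField n X) (hK : IsOperatorFrobeniusAlgebra K)
    (a : Fin n → ℝ) (ha : ∀ x, (frobeniusForm K a x).det ≠ 0)
    (M : Fin n → OpField n X) (hM : M = dualBasis K a)
    (hsym : MutualSymmetriesOn univ K) :
    -- (1)
    MutualSymmetriesOn univ M ∧
    -- (2)
    (∀ U : Set X, IsOpen U →
      -- the equivalence for given coefficients `h^1, …, h^n`, with `h = ∑ a_s h^s`
      (∀ h : Fin n → X → ℝ, (∀ i, SmoothFunOn n U (h i)) →
        (IsCommonSymmetryOn U K (combination h K) ↔
          IsCommonConservationLawOn U M (differential n (fun x => ∑ s, a s * h s x)) ∧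
            ∀ i, ∀ x ∈ U, pullForm (M i) (differential n (fun y => ∑ s, a s * h s y)) x =
              differential n (h i) x)) ∧
      -- the common conservation laws of the `M^i` are exactly the forms that arise so, locally
      (∀ f : X → ℝ, SmoothFunOn n U f →
        (IsCommonConservationLawOn U M (differential n f) ↔
          ∀ x ∈ U, ∃ V : Set X, IsOpen V ∧ x ∈ V ∧ V ⊆ U ∧ ∃ h : Fin n → X → ℝ,
            (∀ i, SmoothFunOn n V (h i)) ∧
            (∀ y ∈ V, differential n (fun z => ∑ s, a s * h s z) y = differential n f y) ∧
            (∀ i, ∀ y ∈ V, pullForm (M i) (differential n f) y = differential n (h i) y) ∧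
            IsCommonSymmetryOn V K (combination h K)))) ∧
    -- (3)
    (∀ β : Fin n → ℝ,
      (∀ x : X, ContinuousLinearMap.id ℝ (TangentSpace (𝓡 n) x) = ∑ i, β i • K i x) →
      ∀ U : Set X, IsOpen U →
        -- `d f` is a common conservation law iff locally `K_i^* d f = d f_i` has a solution that
        -- gives a common symmetry
        (∀ f : X → ℝ, SmoothFunOn n U f →
          (IsCommonConservationLawOn U K (differential n f) ↔
            ∀ x ∈ U, ∃ V : Set X, IsOpen V ∧ x ∈ V ∧ V ⊆ U ∧ ∃ F : Fin n → X → ℝ,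
              (∀ i, SmoothFunOn n V (F i)) ∧
              (∀ i, ∀ y ∈ V, pullForm (K i) (differential n f) y = differential n (F i) y) ∧
              IsCommonSymmetryOn V M (combination F M))) ∧
        -- every solution of `K_i^* d f = d f_i` gives a common symmetry
        (∀ f : X → ℝ, SmoothFunOn n U f →
          ∀ F : Fin n → X → ℝ, (∀ i, SmoothFunOn n U (F i)) →
            (∀ i, ∀ y ∈ U, pullForm (K i) (differential n f) y = differential n (F i) y) →
            IsCommonSymmetryOn U M (combination F M)) ∧
        -- every common symmetry `∑ f_i M^i` arises so, with `f = ∑ β^s f_s`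
        (∀ F : Fin n → X → ℝ, (∀ i, SmoothFunOn n U (F i)) →
          IsCommonSymmetryOn U M (combination F M) →
          IsCommonConservationLawOn U K (differential n (fun x => ∑ s, β s * F s x)) ∧
            ∀ i, ∀ y ∈ U, pullForm (K i) (differential n (fun x => ∑ s, β s * F s x)) y =
              differential n (F i) y)) := by
  subst hM
  have hsymM := hK.mutualSymmetriesOn_dualBasis ha hsym
  refine ⟨hsymM, fun U hU =>
    ⟨fun h hh => isCommonSymmetryOn_combination_iff_isCommonConservationLawOn hK ha hsym hU hh,
      fun f hf =>
        isCommonConservationLawOn_dualBasis_iff_exists_differential_eq hK ha hsym hU hf⟩,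
    fun β hβ U hU => ?_⟩
  have hKM := isOperatorFrobeniusAlgebra_dualBasis hK ha
  have hdet := det_frobeniusForm_dualBasis_ne_zero hK ha hβ
  have hdual := dualBasis_dualBasis hK ha hβ
  refine ⟨fun f hf => ?_, fun f _ F hF hfF => ?_, fun F hF hcs => ?_⟩
  · simpa only [hdual] using isCommonConservationLawOn_dualBasis_iff hKM hdet hsymM hU hf
  · exact isCommonSymmetryOn_combination_of_pullForm hKM hdet hsymM hU hF (by rwa [hdual])
  · simpa only [hdual] using
      (isCommonSymmetryOn_combination_iff_isCommonConservationLawOn hKM hdet hsymM hU hF).1 hcs
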